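/- Let $\varphi:[-1,1]\to\mathbb R$ be smooth, put $\lambda(t)=e^{-i\varphi(t)}$, $\bar\lambda=\lambda^{-1}$, and write $(x^1,x^2,x^3,x^4)=(a,a^*,b,b^*)$. Let $\mathcal S^4_\lambda$ be the complex unital algebra generated by $a,a^*,b,b^*$ and the smooth functions $f(t)$, $f\in C^\infty([-1,1])$, of a central element $t$ (with their pointwise algebra structure), subject to $x^ix^j=A_{ij}(t)\,x^jx^i$ and $aa^*+bb^*+t^2=1$, where $$A=\begin{pmatrix}1&1&\lambda&\bar\lambda\\1&1&\bar\lambda&\lambda\\ \bar\lambda&\lambda&1&1\\ \lambda&\bar\lambda&1&1\end{pmatrix}.$$ Let $B_{ij}=A_{ij}^{-1}\dot A_{ij}$, and let $\Omega(\mathcal S^4_\lambda)=\bigoplus_n\Omega^n(\mathcal S^4_\lambda)$ be the quotient of the universal differential algebra of $\mathcal S^4_\lambda$ by the differential ideal generated by the one-form relations $$d(f(t))=\dot f(t)\,dt,\qquad x^i\,dt=dt\,x^i,\qquad f(t)\,dt=dt\,f(t),\qquad f(t)\,dx^i=dx^i\,f(t),$$ $$x^i\,dx^j=A_{ij}\,dx^j\,x^i+\tfrac12B_{ij}\,dt\,x^ix^j,\qquad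 a\,da^*+a^*\,da+b\,db^*+b^*\,db+2t\,dt=0$$ for all $i,j$ and all $f\in C^\infty([-1,1])$. Let $$\omega=\tfrac14\left(t\,da\,da^*\,db\,db^*-2a\,dt\,da^*\,db\,db^*+2\,dt\,da\,da^*\,db\,b^*\right)\in\Omega^4(\mathcal S^4_\lambda).$$ Let $S^4\subset\mathbb R^5$ be the unit sphere with its surface measure and its coordinate functions $a=x_0+ix_1$, $b=x_2+ix_3$, $t=x_4$, where $a^*=\bar a$ and $b^*=\bar b$. Then there is a linear map $\eta:\mathcal S^4_\lambda\to C(S^4)$ that sends every ordered monomial $f(t)\,a^j(a^*)^kb^m(b^*)^n$ to the function on $S^4$ given by the same expression, and there is a linear functional $\int:\Omega^4(\mathcal S^4_\lambda)\to\mathbb C$ such that $$\int x\,\omega=\int_{S^4}\eta(x)\quad\text{for all }x\in\mathcal S^4_\lambda,\qquad \int d\rho=0\quad\text{for all }\rho\in\Omega^3(\mathcal S^4_\lambda),\qquad \int\omega=\frac{8\pi^2}{3}.$$ -/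

import Mathlib

open scoped ContDiff

noncomputable section

namespace DynamicalSphere

/-! ## Algebras given by relations -/

section Quotient

variable {R : Type} [Semiring R] [Algebra ℂ R] (r : R → R → Prop)

/-- The quotient of the complex algebra `R` by the relations `r u v`, meaning `u = v`. -/
def Quo : Type := RingQuot r

instance : Semiring (Quo r) := inferInstanceAs (Semiring (RingQuot r))

instance : Algebra ℂ (Quo r) := inferInstanceAs (Algebra ℂ (RingQuot r))

instance : Ring (Quo r) := Algebra.semiringToRing ℂ

/-- The quotient map. -/
def quoMk : R →ₐ[ℂ] Quo r := RingQuot.mkAlgHom ℂ r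

variable {r} in
theorem quoMk_rel {u v : R} (h : r u v) : quoMk r u = quoMk r v :=
  RingQuot.mkAlgHom_rel ℂ h

variable {B : Type} [Semiring B] [Algebra ℂ B]

/-- The homomorphism on the quotient that is induced by one respecting the relations. -/
def quoLift (f : R →ₐ[ℂ] B) (hf : ∀ ⦃u v : R⦄, r u v → f u = f v) : Quo r →ₐ[ℂ] B :=
  RingQuot.liftAlgHom ℂ ⟨f, hf⟩

theorem quoLift_mk (f : R →ₐ[ℂ] B) (hf : ∀ ⦃u v : R⦄, r u v → f u = f v) (u : R) :
    quoLift r f hf (quoMk r u) = f u :=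
  RingQuot.liftAlgHom_mkAlgHom_apply ℂ f hf u

end Quotient

/-! ## The universal differential algebra of a complex algebra -/

section Universal

/-- Generators of the universal differential algebra: `el x` is the element `x` of the algebra,
`df x` is the symbol `dx`. -/
inductive FormLetter (A : Type) : Type
  | el (x : A) : FormLetter A
  | df (x : A) : FormLetter A

/-- Defining relations of the universal differential algebra: `x ↦ el x` is a unital algebra
homomorphism, `x ↦ df x` is linear and satisfies the Leibniz rule (so that `d1 = 0`). -/
inductive UnivRel (A : Type) [Ring A] [Algebra ℂ A] :
    FreeAlgebra ℂ (FormLetter A) → FreeAlgebra ℂ (FormLetter A) → Prop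
  | el_scalar (c : ℂ) :
      UnivRel A (FreeAlgebra.ι ℂ (.el (algebraMap ℂ A c)))
        (algebraMap ℂ (FreeAlgebra ℂ (FormLetter A)) c)
  | el_add (x y : A) :
      UnivRel A (FreeAlgebra.ι ℂ (.el (x + y)))
        (FreeAlgebra.ι ℂ (.el x) + FreeAlgebra.ι ℂ (.el y))
  | el_mul (x y : A) :
      UnivRel A (FreeAlgebra.ι ℂ (.el (x * y)))
        (FreeAlgebra.ι ℂ (.el x) * FreeAlgebra.ι ℂ (.el y))
  | df_smul (c : ℂ) (x : A) :
      UnivRel A (FreeAlgebra.ι ℂ (.df (c • x))) (c • FreeAlgebra.ι ℂ (.df x))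
  | df_add (x y : A) :
      UnivRel A (FreeAlgebra.ι ℂ (.df (x + y)))
        (FreeAlgebra.ι ℂ (.df x) + FreeAlgebra.ι ℂ (.df y))
  | df_mul (x y : A) :
      UnivRel A (FreeAlgebra.ι ℂ (.df (x * y)))
        (FreeAlgebra.ι ℂ (.df x) * FreeAlgebra.ι ℂ (.el y)
          + FreeAlgebra.ι ℂ (.el x) * FreeAlgebra.ι ℂ (.df y))

/-- The universal differential algebra `Ω_u(A)`. -/
abbrev UnivForms (A : Type) [Ring A] [Algebra ℂ A] : Type := Quo (UnivRel A)

variable (A : Type) [Ring A] [Algebra ℂ A]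

/-- The inclusion `A → Ω_u(A)`. -/
def uEl : A →ₐ[ℂ] UnivForms A :=
  AlgHom.ofLinearMap
    { toFun := fun x => quoMk (UnivRel A) (FreeAlgebra.ι ℂ (.el x))
      map_add' := fun x y => by
        rw [quoMk_rel (UnivRel.el_add x y), map_add]
      map_smul' := fun c x => by
        rw [Algebra.smul_def, quoMk_rel (UnivRel.el_mul _ x), map_mul,
          quoMk_rel (UnivRel.el_scalar c), AlgHom.commutes, RingHom.id_apply,
          Algebra.smul_def] }
    (by
      change quoMk (UnivRel A) (FreeAlgebra.ι ℂ (.el 1)) = 1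
      have h := quoMk_rel (UnivRel.el_scalar (A := A) 1)
      simpa using h)
    (fun x y => by
      change quoMk (UnivRel A) (FreeAlgebra.ι ℂ (.el (x * y))) = _
      rw [quoMk_rel (UnivRel.el_mul x y), map_mul]
      rfl)

/-- The map `x ↦ dx` from `A` to `Ω_u(A)`. -/
def uD : A →ₗ[ℂ] UnivForms A where
  toFun := fun x => quoMk (UnivRel A) (FreeAlgebra.ι ℂ (.df x))
  map_add' := fun x y => by
    rw [quoMk_rel (UnivRel.df_add x y), map_add]
  map_smul' := fun c x => by
    rw [quoMk_rel (UnivRel.df_smul c x), map_smul, RingHom.id_apply]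

theorem uD_mul (x y : A) : uD A (x * y) = uD A x * uEl A y + uEl A x * uD A y := by
  change quoMk (UnivRel A) (FreeAlgebra.ι ℂ (.df (x * y))) = _
  rw [quoMk_rel (UnivRel.df_mul x y), map_add, map_mul, map_mul]
  rfl

/-- The homomorphism `u ↦ !![γ u, d u; 0, u]`, where `γ` is the sign automorphism of the grading
(`γ x = x`, `γ (dx) = -dx`) and `d` is the graded derivation with `d(x) = dx`, `d(dx) = 0`.
Multiplicativity of this map is the graded Leibniz rule `d(u v) = (d u) v + γ(u) (d v)`. -/
def uDouble : UnivForms A →ₐ[ℂ] Matrix (Fin 2) (Fin 2) (UnivForms A) :=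
  quoLift (UnivRel A)
    (FreeAlgebra.lift ℂ (fun l => match l with
      | .el x => !![uEl A x, uD A x; 0, uEl A x]
      | .df x => !![-uD A x, 0; 0, uD A x])) (by
      intro u v h
      induction h with
      | el_scalar c =>
        have h0 : uD A (algebraMap ℂ A c) = 0 := by
          have h1 : uD A 1 = 0 := by
            have := uD_mul A 1 1
            simpa using this
          rw [Algebra.algebraMap_eq_smul_one, map_smul, h1, smul_zero]
        ext i j
        fin_cases i <;> fin_cases j <;>
          simp [h0, Matrix.algebraMap_matrix_apply]
      | el_add x y =>
        ext i j
        fin_cases i <;> fin_cases j <;> simp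
      | el_mul x y =>
        ext i j
        fin_cases i <;> fin_cases j <;>
          simp [Matrix.mul_apply, Fin.sum_univ_two, uD_mul, add_comm]
      | df_smul c x =>
        ext i j
        fin_cases i <;> fin_cases j <;> simp
      | df_add x y =>
        ext i j
        fin_cases i <;> fin_cases j <;> simp [add_comm]
      | df_mul x y =>
        ext i j
        fin_cases i <;> fin_cases j <;>
          simp [uD_mul, add_comm])

theorem uDouble_uEl (x : A) : uDouble A (uEl A x) = !![uEl A x, uD A x; 0, uEl A x] := by
  change quoLift _ _ _ (quoMk (UnivRel A) _) = _
  rw [quoLift_mk, FreeAlgebra.lift_ι_apply]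

theorem uDouble_uD (x : A) : uDouble A (uD A x) = !![-uD A x, 0; 0, uD A x] := by
  change quoLift _ _ _ (quoMk (UnivRel A) _) = _
  rw [quoLift_mk, FreeAlgebra.lift_ι_apply]

/-- The differential of `Ω_u(A)`. -/
def uDiff : UnivForms A →ₗ[ℂ] UnivForms A where
  toFun u := uDouble A u 0 1
  map_add' u v := by simp
  map_smul' c u := by simp

/-- The universal one-forms `Ω_u¹(A) = A · dA`. -/
def univOneForms : Submodule ℂ (UnivForms A) :=
  LinearMap.range (uEl A).toLinearMap * LinearMap.range (uD A)

theorem uOne_shape {u : UnivForms A} (hu : u ∈ univOneForms A) :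
    uDouble A u = !![-u, uDiff A u; 0, u] ∧
      uDouble A (uDiff A u) = !![uDiff A u, 0; 0, uDiff A u] := by
  induction hu using Submodule.mul_induction_on' with
  | mem_mul_mem m hm n hn =>
    obtain ⟨x, rfl⟩ := hm
    obtain ⟨y, rfl⟩ := hn
    have h : uDouble A (uEl A x * uD A y) =
        !![-(uEl A x * uD A y), uD A x * uD A y; 0, uEl A x * uD A y] := by
      rw [map_mul, uDouble_uEl, uDouble_uD]
      ext i j
      fin_cases i <;> fin_cases j <;> simp [Matrix.mul_apply, Fin.sum_univ_two]
    have h1 : uDiff A (uEl A x * uD A y) = uD A x * uD A y := by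
      change uDouble A (uEl A x * uD A y) 0 1 = _
      rw [h]; rfl
    change uDouble A (uEl A x * uD A y) = _ ∧ uDouble A (uDiff A (uEl A x * uD A y)) = _
    refine ⟨?_, ?_⟩
    · rw [h]
      change _ = !![_, uDiff A (uEl A x * uD A y); 0, _]
      rw [h1]; rfl
    · change _ = !![uDiff A (uEl A x * uD A y), 0; 0, uDiff A (uEl A x * uD A y)]
      rw [h1, map_mul, uDouble_uD, uDouble_uD]
      ext i j
      fin_cases i <;> fin_cases j <;> simp [Matrix.mul_apply, Fin.sum_univ_two]
  | add u hu v hv ihu ihv =>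
    refine ⟨?_, ?_⟩
    · rw [map_add, ihu.1, ihv.1, map_add]
      ext i j
      fin_cases i <;> fin_cases j <;> simp [add_comm]
    · rw [map_add, map_add, ihu.2, ihv.2]
      ext i j
      fin_cases i <;> fin_cases j <;> simp

theorem uD_mem_one (x : A) : uD A x ∈ univOneForms A := by
  have := Submodule.mul_mem_mul (M := LinearMap.range (uEl A).toLinearMap)
    (N := LinearMap.range (uD A)) ⟨1, rfl⟩ ⟨x, rfl⟩
  simpa [univOneForms] using this

theorem el_mul_mem_one (x : A) {u : UnivForms A} (hu : u ∈ univOneForms A) :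
    uEl A x * u ∈ univOneForms A := by
  induction hu using Submodule.mul_induction_on' with
  | mem_mul_mem m hm n hn =>
    obtain ⟨z, rfl⟩ := hm
    rw [← mul_assoc]
    exact Submodule.mul_mem_mul ⟨x * z, by simp⟩ hn
  | add u hu v hv ihu ihv => rw [mul_add]; exact add_mem ihu ihv

theorem mul_el_mem_one (x : A) {u : UnivForms A} (hu : u ∈ univOneForms A) :
    u * uEl A x ∈ univOneForms A := by
  induction hu using Submodule.mul_induction_on' with
  | mem_mul_mem m hm n hn =>
    obtain ⟨z, rfl⟩ := hm
    obtain ⟨y, rfl⟩ := hn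
    have h : uD A y * uEl A x = uD A (y * x) - uEl A y * uD A x := by
      rw [uD_mul]; abel
    rw [mul_assoc, h]
    exact el_mul_mem_one A z (sub_mem (uD_mem_one A _) (el_mul_mem_one A y (uD_mem_one A x)))
  | add u hu v hv ihu ihv => rw [add_mul]; exact add_mem ihu ihv

end Universal

/-! ## The differential algebra with prescribed relations between one-forms -/

section Calculus

variable {A : Type} [Ring A] [Algebra ℂ A]

/-- Generators of the differential ideal: the given one-forms and their differentials. -/
inductive CalcRel (J : Set (UnivForms A)) : UnivForms A → UnivForms A → Prop
  | form (j : UnivForms A) (hj : j ∈ J) : CalcRel J j 0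
  | diff (j : UnivForms A) (hj : j ∈ J) : CalcRel J (uDiff A j) 0

/-- The quotient of `Ω_u(A)` by the differential ideal generated by `J` and `dJ`. -/
abbrev Forms (J : Set (UnivForms A)) : Type := Quo (CalcRel J)

variable (J : Set (UnivForms A))

/-- The quotient map `Ω_u(A) → Ω(A)`. -/
def fProj : UnivForms A →ₐ[ℂ] Forms J := quoMk (CalcRel J)

/-- The map `A → Ω(A)`. -/
def fEl : A →ₐ[ℂ] Forms J := (fProj J).comp (uEl A)

/-- The map `x ↦ dx` from `A` to `Ω(A)`. -/
def fD : A →ₗ[ℂ] Forms J := (fProj J).toLinearMap ∘ₗ uD A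

theorem fD_mul (x y : A) : fD J (x * y) = fD J x * fEl J y + fEl J x * fD J y := by
  simp [fD, fEl, uD_mul]

/-- The homomorphism `u ↦ !![γ u, d u; 0, u]` on the quotient. -/
def fDouble (hJ : J ⊆ univOneForms A) : Forms J →ₐ[ℂ] Matrix (Fin 2) (Fin 2) (Forms J) :=
  quoLift (CalcRel J) ((fProj J).mapMatrix.comp (uDouble A)) (by
    intro u v h
    induction h with
    | form j hj =>
      have h1 : fProj J j = 0 := by
        simpa [fProj] using quoMk_rel (CalcRel.form j hj)
      have h2 : fProj J (uDiff A j) = 0 := by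
        simpa [fProj] using quoMk_rel (CalcRel.diff j hj)
      rw [AlgHom.comp_apply, (uOne_shape A (hJ hj)).1, map_zero]
      ext i k
      fin_cases i <;> fin_cases k <;> simp [h1, h2]
    | diff j hj =>
      have h2 : fProj J (uDiff A j) = 0 := by
        simpa [fProj] using quoMk_rel (CalcRel.diff j hj)
      rw [AlgHom.comp_apply, (uOne_shape A (hJ hj)).2, map_zero]
      ext i k
      fin_cases i <;> fin_cases k <;> simp [h2])

theorem fDouble_fProj (hJ : J ⊆ univOneForms A) (u : UnivForms A) :
    fDouble J hJ (fProj J u) = (fProj J).mapMatrix (uDouble A u) := by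
  change quoLift _ _ _ (quoMk (CalcRel J) u) = _
  rw [quoLift_mk]
  rfl

/-- The differential `d` of `Ω(A)`. -/
def fDiff (hJ : J ⊆ univOneForms A) : Forms J →ₗ[ℂ] Forms J where
  toFun u := fDouble J hJ u 0 1
  map_add' u v := by simp
  map_smul' c u := by simp

theorem fDiff_fProj (hJ : J ⊆ univOneForms A) (u : UnivForms A) :
    fDiff J hJ (fProj J u) = fProj J (uDiff A u) := by
  change fDouble J hJ (fProj J u) 0 1 = _
  rw [fDouble_fProj]
  rfl

theorem fDiff_fEl (hJ : J ⊆ univOneForms A) (x : A) : fDiff J hJ (fEl J x) = fD J x := by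
  change fDiff J hJ (fProj J (uEl A x)) = _
  rw [fDiff_fProj]
  change fProj J (uDouble A (uEl A x) 0 1) = _
  rw [uDouble_uEl]
  rfl

theorem fDiff_mul_fD (hJ : J ⊆ univOneForms A) (u : Forms J) (x : A) :
    fDiff J hJ (u * fD J x) = fDiff J hJ u * fD J x := by
  have h : fDouble J hJ (fD J x) = !![-fD J x, 0; 0, fD J x] := by
    change fDouble J hJ (fProj J (uD A x)) = _
    rw [fDouble_fProj, uDouble_uD]
    ext i j
    fin_cases i <;> fin_cases j <;> simp [fD]
  change fDouble J hJ (u * fD J x) 0 1 = fDouble J hJ u 0 1 * _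
  rw [map_mul, h]
  simp [Matrix.mul_apply, Fin.sum_univ_two]

/-- The forms of degree `n`: `Ωⁿ(A) = A · dA ⋯ dA` with `n` factors `dA`. -/
def nForms (n : ℕ) : Submodule ℂ (Forms J) :=
  LinearMap.range (fEl J).toLinearMap * LinearMap.range (fD J) ^ n

theorem nForms_succ (n : ℕ) : nForms J (n + 1) = nForms J n * LinearMap.range (fD J) := by
  rw [nForms, nForms, pow_succ, mul_assoc]

theorem el_mem_zero (x : A) : fEl J x ∈ nForms J 0 := by
  rw [nForms, pow_zero, mul_one]
  exact ⟨x, rfl⟩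

theorem mul_fD_mem {n : ℕ} {u : Forms J} (hu : u ∈ nForms J n) (x : A) :
    u * fD J x ∈ nForms J (n + 1) := by
  rw [nForms_succ]
  exact Submodule.mul_mem_mul hu ⟨x, rfl⟩

theorem el_mul_mem {n : ℕ} (x : A) {u : Forms J} (hu : u ∈ nForms J n) :
    fEl J x * u ∈ nForms J n := by
  induction hu using Submodule.mul_induction_on' with
  | mem_mul_mem m hm k hk =>
    obtain ⟨z, rfl⟩ := hm
    rw [← mul_assoc]
    exact Submodule.mul_mem_mul ⟨x * z, by simp⟩ hk
  | add u hu v hv ihu ihv => rw [mul_add]; exact add_mem ihu ihv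

theorem mul_el_mem {n : ℕ} (x : A) {u : Forms J} (hu : u ∈ nForms J n) :
    u * fEl J x ∈ nForms J n := by
  induction n generalizing x u with
  | zero =>
    rw [nForms, pow_zero, mul_one] at hu ⊢
    obtain ⟨z, rfl⟩ := hu
    exact ⟨z * x, by simp⟩
  | succ n ih =>
    rw [nForms_succ] at hu
    induction hu using Submodule.mul_induction_on' with
    | mem_mul_mem m hm k hk =>
      obtain ⟨y, rfl⟩ := hk
      have h : fD J y * fEl J x = fD J (y * x) - fEl J y * fD J x := by
        rw [fD_mul]; abel
      rw [mul_assoc, h, mul_sub, ← mul_assoc]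
      exact sub_mem (mul_fD_mem J hm _) (mul_fD_mem J (ih y hm) _)
    | add u hu v hv ihu ihv => rw [add_mul]; exact add_mem ihu ihv

theorem fDiff_mem (hJ : J ⊆ univOneForms A) {n : ℕ} {u : Forms J} (hu : u ∈ nForms J n) :
    fDiff J hJ u ∈ nForms J (n + 1) := by
  induction n generalizing u with
  | zero =>
    rw [nForms, pow_zero, mul_one] at hu
    obtain ⟨x, rfl⟩ := hu
    have h := mul_fD_mem J (el_mem_zero J 1) x
    rw [map_one, one_mul] at h
    change fDiff J hJ (fEl J x) ∈ _
    rw [fDiff_fEl]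
    exact h
  | succ n ih =>
    rw [nForms_succ] at hu
    induction hu using Submodule.mul_induction_on' with
    | mem_mul_mem m hm k hk =>
      obtain ⟨y, rfl⟩ := hk
      rw [fDiff_mul_fD]
      exact mul_fD_mem J (ih hm) y
    | add u hu v hv ihu ihv => rw [map_add]; exact add_mem ihu ihv

/-- The differential `d : Ωⁿ(A) → Ωⁿ⁺¹(A)`. -/
def nDiff (hJ : J ⊆ univOneForms A) (n : ℕ) : nForms J n →ₗ[ℂ] nForms J (n + 1) :=
  (fDiff J hJ).restrict (fun _ hu => fDiff_mem J hJ hu)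

/-- Left multiplication of forms of degree `n` by elements of the algebra. -/
def nLeft (n : ℕ) (x : A) (u : nForms J n) : nForms J n :=
  ⟨fEl J x * u, el_mul_mem J x u.2⟩

end Calculus

/-! ## Smooth functions on the interval `[-1, 1]` -/

/-- The algebra `C^∞([-1, 1])` of smooth complex functions on the closed interval. -/
def SmoothFn : Subalgebra ℂ (Set.Icc (-1 : ℝ) 1 → ℂ) where
  carrier := {f | ∃ F : ℝ → ℂ, ContDiffOn ℝ ∞ F (Set.Icc (-1) 1) ∧ ∀ s, f s = F s}
  mul_mem' := by
    rintro f g ⟨F, hF, hf⟩ ⟨G, hG, hg⟩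
    exact ⟨fun s => F s * G s, hF.mul hG, fun s => by simp [hf, hg]⟩
  add_mem' := by
    rintro f g ⟨F, hF, hf⟩ ⟨G, hG, hg⟩
    exact ⟨fun s => F s + G s, hF.add hG, fun s => by simp [hf, hg]⟩
  algebraMap_mem' := fun c => ⟨fun _ => c, contDiffOn_const, fun _ => rfl⟩

/-- The coordinate function `s ↦ s` on `[-1, 1]`. -/
def coordFn : SmoothFn :=
  ⟨fun s => ((s : ℝ) : ℂ), fun s => (s : ℂ), Complex.ofRealCLM.contDiff.contDiffOn,
    fun _ => rfl⟩

/-- The complex conjugate of a smooth function. -/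
def conjFn (f : SmoothFn) : SmoothFn :=
  ⟨fun s => starRingEnd ℂ (f.1 s), by
    obtain ⟨F, hF, hf⟩ := f.2
    exact ⟨fun s => starRingEnd ℂ (F s), Complex.conjCLE.contDiff.comp_contDiffOn hF,
      fun s => congrArg (starRingEnd ℂ) (hf s)⟩⟩

/-- The derivative of a smooth function on `[-1, 1]` (one-sided at the end points). -/
def derivFn (f : SmoothFn) : SmoothFn :=
  ⟨fun s => derivWithin (Set.IccExtend (by norm_num) f.1) (Set.Icc (-1) 1) (s : ℝ), by
    obtain ⟨F, hF, hf⟩ := f.2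
    refine ⟨derivWithin (Set.IccExtend (by norm_num) f.1) (Set.Icc (-1) 1), ?_, fun _ => rfl⟩
    have h : ContDiffOn ℝ ∞ (Set.IccExtend (by norm_num : (-1 : ℝ) ≤ 1) f.1)
        (Set.Icc (-1) 1) :=
      hF.congr (fun s hs => by rw [Set.IccExtend_of_mem _ _ hs, hf])
    exact h.derivWithin (uniqueDiffOn_Icc (by norm_num)) (by simp)⟩

/-- The unitary function `λ(s) = exp(-i φ(s))`. -/
def lam (φ : ℝ → ℝ) (hφ : ContDiffOn ℝ ∞ φ (Set.Icc (-1) 1)) : SmoothFn :=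
  ⟨fun s => Complex.exp (-(Complex.I * (φ s : ℂ))), fun s => Complex.exp (-(Complex.I * (φ s : ℂ))),
    ((contDiffOn_const.mul (Complex.ofRealCLM.contDiff.comp_contDiffOn hφ)).neg).cexp,
    fun _ => rfl⟩

/-! ## The deformed sphere -/

section Sphere

variable (l : SmoothFn)

/-- The commutation matrix; the indices `0, 1, 2, 3` stand for `a, a*, b, b*`. -/
def commA : Matrix (Fin 4) (Fin 4) SmoothFn :=
  !![1, 1, l, conjFn l;
     1, 1, conjFn l, l;
     conjFn l, l, 1, 1;
     l, conjFn l, 1, 1]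

/-- `B_ij = A_ij⁻¹ A_ij'`, where the inverse of the unitary `A_ij` is its conjugate. -/
def commB (i j : Fin 4) : SmoothFn := conjFn (commA l i j) * derivFn (commA l i j)

/-- Generators of the deformed sphere: `x 0, x 1, x 2, x 3` are `a, a*, b, b*`, and `fn f` is the
smooth function `f` of the central element `t`. -/
inductive SphereLetter : Type
  | x (i : Fin 4) : SphereLetter
  | fn (f : SmoothFn) : SphereLetter

/-- Defining relations of the deformed sphere. -/
inductive SphereRel :
    FreeAlgebra ℂ SphereLetter → FreeAlgebra ℂ SphereLetter → Prop
  | fn_scalar (c : ℂ) :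
      SphereRel (FreeAlgebra.ι ℂ (.fn (algebraMap ℂ SmoothFn c))) (algebraMap ℂ _ c)
  | fn_add (f g : SmoothFn) :
      SphereRel (FreeAlgebra.ι ℂ (.fn (f + g)))
        (FreeAlgebra.ι ℂ (.fn f) + FreeAlgebra.ι ℂ (.fn g))
  | fn_mul (f g : SmoothFn) :
      SphereRel (FreeAlgebra.ι ℂ (.fn (f * g)))
        (FreeAlgebra.ι ℂ (.fn f) * FreeAlgebra.ι ℂ (.fn g))
  | central (f : SmoothFn) (i : Fin 4) :
      SphereRel (FreeAlgebra.ι ℂ (.x i) * FreeAlgebra.ι ℂ (.fn f))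
        (FreeAlgebra.ι ℂ (.fn f) * FreeAlgebra.ι ℂ (.x i))
  | comm (i j : Fin 4) :
      SphereRel (FreeAlgebra.ι ℂ (.x i) * FreeAlgebra.ι ℂ (.x j))
        (FreeAlgebra.ι ℂ (.fn (commA l i j)) * (FreeAlgebra.ι ℂ (.x j) * FreeAlgebra.ι ℂ (.x i)))
  | sphere :
      SphereRel
        (FreeAlgebra.ι ℂ (.x 0) * FreeAlgebra.ι ℂ (.x 1)
          + FreeAlgebra.ι ℂ (.x 2) * FreeAlgebra.ι ℂ (.x 3)
          + FreeAlgebra.ι ℂ (.fn coordFn) ^ 2) 1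

/-- The algebra of the deformed sphere `S⁴_λ`. -/
abbrev DefSphere : Type := Quo (SphereRel l)

/-- The generators `a, a*, b, b*`. -/
def gen (i : Fin 4) : DefSphere l :=
  quoMk (SphereRel l) (FreeAlgebra.ι ℂ (.x i))

/-- The element `f(t)`. -/
def fnT (f : SmoothFn) : DefSphere l :=
  quoMk (SphereRel l) (FreeAlgebra.ι ℂ (.fn f))

/-- The central element `t`. -/
def tEl : DefSphere l := fnT l coordFn

/-- The relations between one-forms that define the calculus: `d(f(t)) = f'(t) dt`, the form `dt`
is central, functions of `t` commute with the forms `dxⁱ`,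
`xⁱ dxʲ = A_ij dxʲ xⁱ + ½ B_ij dt xⁱ xʲ`, and
`a da* + a* da + b db* + b* db + 2 t dt = 0`. -/
inductive OneFormRel : UnivForms (DefSphere l) → Prop
  | chain (f : SmoothFn) :
      OneFormRel (uD _ (fnT l f) - uEl _ (fnT l (derivFn f)) * uD _ (tEl l))
  | dt_gen (i : Fin 4) :
      OneFormRel (uEl _ (gen l i) * uD _ (tEl l) - uD _ (tEl l) * uEl _ (gen l i))
  | dt_fn (f : SmoothFn) :
      OneFormRel (uEl _ (fnT l f) * uD _ (tEl l) - uD _ (tEl l) * uEl _ (fnT l f))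
  | fn_dgen (f : SmoothFn) (i : Fin 4) :
      OneFormRel (uEl _ (fnT l f) * uD _ (gen l i) - uD _ (gen l i) * uEl _ (fnT l f))
  | comm (i j : Fin 4) :
      OneFormRel (uEl _ (gen l i) * uD _ (gen l j)
        - (uEl _ (fnT l (commA l i j)) * (uD _ (gen l j) * uEl _ (gen l i))
          + (1 / 2 : ℂ) • (uEl _ (fnT l (commB l i j)) *
              (uD _ (tEl l) * uEl _ (gen l i * gen l j)))))
  | sphere :
      OneFormRel (uEl _ (gen l 0) * uD _ (gen l 1) + uEl _ (gen l 1) * uD _ (gen l 0)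
        + uEl _ (gen l 2) * uD _ (gen l 3) + uEl _ (gen l 3) * uD _ (gen l 2)
        + (2 : ℂ) • (uEl _ (tEl l) * uD _ (tEl l)))

/-- The set of relations between one-forms. -/
def oneFormRels : Set (UnivForms (DefSphere l)) := {u | OneFormRel l u}

theorem oneFormRels_subset : oneFormRels l ⊆ univOneForms (DefSphere l) := by
  intro u hu
  have hd := uD_mem_one (DefSphere l)
  have hL : ∀ (x : DefSphere l) {u : UnivForms (DefSphere l)}, u ∈ univOneForms (DefSphere l) →
    uEl _ x * u ∈ univOneForms (DefSphere l) := fun x _ h => el_mul_mem_one _ x h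
  have hR : ∀ (x : DefSphere l) {u : UnivForms (DefSphere l)}, u ∈ univOneForms (DefSphere l) →
    u * uEl _ x ∈ univOneForms (DefSphere l) := fun x _ h => mul_el_mem_one _ x h
  change u ∈ univOneForms (DefSphere l)
  induction (show OneFormRel l u from hu) with
  | chain f => exact sub_mem (hd _) (hL _ (hd _))
  | dt_gen i => exact sub_mem (hL _ (hd _)) (hR _ (hd _))
  | dt_fn f => exact sub_mem (hL _ (hd _)) (hR _ (hd _))
  | fn_dgen f i => exact sub_mem (hL _ (hd _)) (hR _ (hd _))
  | comm i j =>
    exact sub_mem (hL _ (hd _)) (add_mem (hL _ (hR _ (hd _)))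
      (Submodule.smul_mem _ _ (hL _ (hR _ (hd _)))))
  | sphere =>
    exact add_mem (add_mem (add_mem (add_mem (hL _ (hd _)) (hL _ (hd _))) (hL _ (hd _)))
      (hL _ (hd _))) (Submodule.smul_mem _ _ (hL _ (hd _)))

/-- The differential algebra `Ω(S⁴_λ)`. -/
abbrev SphereAllForms : Type := Forms (oneFormRels l)

/-- The space `Ωⁿ(S⁴_λ)` of forms of degree `n`. -/
abbrev SphereForms (n : ℕ) : Submodule ℂ (SphereAllForms l) := nForms (oneFormRels l) n

/-- The differential `d : Ωⁿ(S⁴_λ) → Ωⁿ⁺¹(S⁴_λ)`. -/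
def sphereD (n : ℕ) : SphereForms l n →ₗ[ℂ] SphereForms l (n + 1) :=
  nDiff (oneFormRels l) (oneFormRels_subset l) n

/-- The form
`ω = ¼ (t da da* db db* - 2 a dt da* db db* + 2 dt da da* db b*)` of degree four. -/
def omega : SphereForms l 4 :=
  let el := fEl (oneFormRels l)
  let d := fD (oneFormRels l)
  let a := gen l 0
  let a' := gen l 1
  let b := gen l 2
  let b' := gen l 3
  let t := tEl l
  ⟨(1 / 4 : ℂ) • (el t * d a * d a' * d b * d b'
      - (2 : ℂ) • (el a * d t * d a' * d b * d b')
      + (2 : ℂ) • (d t * d a * d a' * d b * el b')), by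
    have h : ∀ x y z u v : DefSphere l, el x * d y * d z * d u * d v ∈ SphereForms l 4 :=
      fun x y z u v => mul_fD_mem _ (mul_fD_mem _ (mul_fD_mem _ (mul_fD_mem _
        (el_mem_zero _ x) y) z) u) v
    have h1 : d t * d a * d a' * d b * el b' ∈ SphereForms l 4 := by
      have := h 1 t a a' b
      rw [map_one, one_mul] at this
      exact mul_el_mem _ b' this
    exact Submodule.smul_mem _ _ (add_mem (sub_mem (h _ _ _ _ _)
      (Submodule.smul_mem _ _ (h _ _ _ _ _))) (Submodule.smul_mem _ _ h1))⟩

/-- The form `x θ` of degree four, for `x` in the algebra and `θ` of degree four. -/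
def mulForm (x : DefSphere l) (θ : SphereForms l 4) : SphereForms l 4 :=
  nLeft (oneFormRels l) 4 x θ

end Sphere

/-! ## The classical sphere and the ordering map -/

/-- The classical unit sphere `S⁴` in `ℝ⁵`. -/
abbrev S4 : Type := Metric.sphere (0 : EuclideanSpace ℝ (Fin 5)) 1

theorem coord_mem (p : S4) : (p : EuclideanSpace ℝ (Fin 5)) 4 ∈ Set.Icc (-1 : ℝ) 1 := by
  have h := PiLp.norm_apply_le (p : EuclideanSpace ℝ (Fin 5)) 4
  have hp : ‖(p : EuclideanSpace ℝ (Fin 5))‖ = 1 := by simp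
  rw [hp, Real.norm_eq_abs] at h
  exact abs_le.mp h

/-- The classical coordinate functions `a = x₀ + i x₁`, `a* = x₀ - i x₁`, `b = x₂ + i x₃`,
`b* = x₂ - i x₃` on `S⁴`. -/
def classGen : Fin 4 → C(S4, ℂ) :=
  ![⟨fun p => (p.1 0 : ℂ) + Complex.I * (p.1 1 : ℂ), by fun_prop⟩,
    ⟨fun p => (p.1 0 : ℂ) - Complex.I * (p.1 1 : ℂ), by fun_prop⟩,
    ⟨fun p => (p.1 2 : ℂ) + Complex.I * (p.1 3 : ℂ), by fun_prop⟩,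
    ⟨fun p => (p.1 2 : ℂ) - Complex.I * (p.1 3 : ℂ), by fun_prop⟩]

/-- The classical function `f(t)` on `S⁴`, where `t = x₄`. -/
def classFn (f : SmoothFn) : C(S4, ℂ) :=
  ⟨fun p => f.1 ⟨(p : EuclideanSpace ℝ (Fin 5)) 4, coord_mem p⟩, by
    obtain ⟨F, hF, hf⟩ := f.2
    have h : Continuous f.1 := by
      have h0 := continuousOn_iff_continuous_domRestrict.mp hF.continuousOn
      have h1 : f.1 = (Set.Icc (-1 : ℝ) 1).domRestrict F := funext hf
      rw [h1]; exact h0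
    exact h.comp (by fun_prop)⟩

/-- `η` is the ordering map: a monomial of the deformed sphere in which `a, a*` stand to the left
of `b, b*` (with a coefficient depending on the central `t`) goes to the function on `S⁴` given by
the same expression. -/
def IsOrderingMap (l : SmoothFn) (η : DefSphere l →ₗ[ℂ] C(S4, ℂ)) : Prop :=
  ∀ (f : SmoothFn) (j k m n : ℕ),
    η (fnT l f * gen l 0 ^ j * gen l 1 ^ k * gen l 2 ^ m * gen l 3 ^ n) =
      classFn f * classGen 0 ^ j * classGen 1 ^ k * classGen 2 ^ m * classGen 3 ^ n

/-- The surface measure of `S⁴`. -/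
def surfaceMeasure : MeasureTheory.Measure S4 :=
  (MeasureTheory.volume : MeasureTheory.Measure (EuclideanSpace ℝ (Fin 5))).toSphere

end DynamicalSphere

end

noncomputable section

namespace DynamicalSphere

/-! ## Representations of differential algebras by graded commutators -/

/-! The deformation is undone by representing the algebra on functions labelled by the characters of
a two-torus. On a direct sum over m ∈ ℤ², let xⁱ act as multiplication by λ^(⟨wᵢ,m⟩/2) yᵢ followed
by the shift m ↦ m + wᵢ. Here wᵢ is the weight of xⁱ, ⟨·,·⟩ is the antisymmetric pairing of weights,
and yᵢ is the classical coordinate. Exchanging two generators changes the phase by λ^⟨wᵢ,wⱼ⟩ = Aᵢⱼ,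
so this is a representation (`twistRep`).

On labelled forms, let dx act as the commutator of the exterior derivative with x. Since λ depends
on t, differentiating the phases produces extra multiples of dt, and these are exactly the terms
½Bᵢⱼ (`formOp_oneFormRels`). Hence the whole calculus acts (`fRep`), and on a closed vector dρ acts
as d after ρ (`fRep_fDiff_apply`).

The integral of θ is obtained by applying θ to the vacuum, which is the function 1 at label 0,
taking the component at label 0, and integrating this classical four-form over S⁴. The forms live on
ℝ⁵∖{0} with coordinates yₖ = xₖ/|x|, so that the sphere equation holds identically and can be
differentiated. A four-form v is integrated through the top coefficient of n∧v, where n = ∑ yₖeₖ.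
Exact forms then integrate to zero because ∫(xₖ∂ₗ − xₗ∂ₖ)g = 0, which is rotation invariance of the
surface measure (`integral_infRot`, `volInt_extD`). Applied to the vacuum, ω collects no phase
(`calcRep_omega`) and gives the classical volume form (`conormal_mul_volForm`). So ∫xω is the
surface integral of the label-0 component of x applied to the vacuum.

An ordered monomial ending at label m collects the phase λ^(m₁m₂/2); η removes it and sums over the
labels (`isOrderingMap_orderMap`). The component at label m has torus weight m, so it integrates to
zero unless m = 0, where there is no correction. Both integrals therefore agree
(`surfInt_orderMap`). -/

theorem quoMk_surjective {R : Type} [Semiring R] [Algebra ℂ R] (r : R → R → Prop) :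
    Function.Surjective (quoMk r) :=
  RingQuot.mkAlgHom_surjective ℂ r

section Representation

variable {A : Type} [Ring A] [Algebra ℂ A] {V : Type} [AddCommGroup V] [Module ℂ V]
  (d : Module.End ℂ V) (ρ : A →ₐ[ℂ] Module.End ℂ V)

/-- The representation of the universal differential algebra in which `dx` acts as the commutator
of the operator `d` with the action of `x`. -/
def uRep : UnivForms A →ₐ[ℂ] Module.End ℂ V :=
  quoLift (UnivRel A)
    (FreeAlgebra.lift ℂ (fun l => match l with
      | .el x => ρ x
      | .df x => d * ρ x - ρ x * d)) (by
      intro u v h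
      induction h with
      | el_scalar c => simp
      | el_add x y => simp
      | el_mul x y => simp
      | df_smul c x => simp [smul_sub]
      | df_add x y => simp [mul_add, add_mul]; abel
      | df_mul x y => simp; noncomm_ring)

theorem uRep_uEl (x : A) : uRep d ρ (uEl A x) = ρ x := by
  change quoLift _ _ _ (quoMk (UnivRel A) _) = _
  rw [quoLift_mk, FreeAlgebra.lift_ι_apply]

theorem uRep_uD (x : A) : uRep d ρ (uD A x) = d * ρ x - ρ x * d := by
  change quoLift _ _ _ (quoMk (UnivRel A) _) = _
  rw [quoLift_mk, FreeAlgebra.lift_ι_apply]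

variable {d}

/-- The upper row of the matrix holds the sign automorphism γ(u) and du. The triangular shape and
the identity du = d∘u − γ(u)∘d both survive products and sums, so the letters suffice. The
hypothesis d² = 0 matters only for the letter dx. -/
theorem uDouble_shape (hd : d * d = 0) (u : UnivForms A) :
    uDouble A u 1 0 = 0 ∧ uDouble A u 1 1 = u ∧
      uRep d ρ (uDiff A u) = d * uRep d ρ u - uRep d ρ (uDouble A u 0 0) * d := by
  change _ ∧ _ ∧ uRep d ρ (uDouble A u 0 1) = _
  obtain ⟨u, rfl⟩ := quoMk_surjective _ u
  induction u using FreeAlgebra.induction with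
  | grade0 c =>
    rw [AlgHom.commutes, AlgHom.commutes]
    simp [Matrix.algebraMap_matrix_apply, Algebra.commutes]
  | grade1 l =>
    cases l with
    | el x =>
      change uDouble A (uEl A x) 1 0 = 0 ∧ uDouble A (uEl A x) 1 1 = uEl A x ∧
        uRep d ρ (uDouble A (uEl A x) 0 1) =
          d * uRep d ρ (uEl A x) - uRep d ρ (uDouble A (uEl A x) 0 0) * d
      rw [uDouble_uEl]
      simp [uRep_uEl, uRep_uD]
    | df x =>
      change uDouble A (uD A x) 1 0 = 0 ∧ uDouble A (uD A x) 1 1 = uD A x ∧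
        uRep d ρ (uDouble A (uD A x) 0 1) =
          d * uRep d ρ (uD A x) - uRep d ρ (uDouble A (uD A x) 0 0) * d
      rw [uDouble_uD]
      simp [uRep_uD, mul_sub, sub_mul, ← mul_assoc, hd]
      simp [mul_assoc, hd]
  | mul u v hu hv =>
    obtain ⟨hu0, hu1, hu2⟩ := hu
    obtain ⟨hv0, hv1, hv2⟩ := hv
    rw [map_mul, map_mul]
    refine ⟨?_, ?_, ?_⟩
    · simp [Matrix.mul_apply, Fin.sum_univ_two, hu0, hv0]
    · simp [Matrix.mul_apply, Fin.sum_univ_two, hu0, hu1, hv1]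
    · simp only [Matrix.mul_apply, Fin.sum_univ_two, hv1, hv0, map_add, map_mul, hu2, hv2,
        mul_zero, add_zero]
      noncomm_ring
  | add u v hu hv =>
    obtain ⟨hu0, hu1, hu2⟩ := hu
    obtain ⟨hv0, hv1, hv2⟩ := hv
    rw [map_add, map_add]
    refine ⟨?_, ?_, ?_⟩
    · simp [hu0, hv0]
    · simp [hu1, hv1]
    · simp only [Matrix.add_apply, map_add, hu2, hv2]
      noncomm_ring

/-! ### Descent to the quotient by a differential ideal -/

variable {J : Set (UnivForms A)}

/-- The representation induced on the quotient differential algebra. -/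
def fRep (hJ : J ⊆ univOneForms A) (hd : d * d = 0) (h : ∀ j ∈ J, uRep d ρ j = 0) :
    Forms J →ₐ[ℂ] Module.End ℂ V :=
  quoLift (CalcRel J) (uRep d ρ) (by
    intro u v huv
    induction huv with
    | form j hj => rw [h j hj, map_zero]
    | diff j hj =>
      -- A one-form satisfies γ(j) = −j, so dj acts as d∘j + j∘d and vanishes together with j. Only
      -- the one-form relations themselves need checking.
      rw [(uDouble_shape ρ hd j).2.2, (uOne_shape A (hJ hj)).1, h j hj]
      simp [h j hj])

variable (hJ : J ⊆ univOneForms A) (hd : d * d = 0) (h : ∀ j ∈ J, uRep d ρ j = 0)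

theorem fRep_fProj (u : UnivForms A) : fRep ρ hJ hd h (fProj J u) = uRep d ρ u := by
  change quoLift _ _ _ (quoMk (CalcRel J) u) = _
  rw [quoLift_mk]

theorem fRep_fEl (x : A) : fRep ρ hJ hd h (fEl J x) = ρ x := by
  rw [← uRep_uEl d ρ]
  exact fRep_fProj ρ hJ hd h _

theorem fRep_fD (x : A) : fRep ρ hJ hd h (fD J x) = d * ρ x - ρ x * d := by
  rw [← uRep_uD d ρ]
  exact fRep_fProj ρ hJ hd h _

/-- On a closed vector the signed term γ(u)∘d disappears, whatever the degree of u. This turns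
exactness in the abstract calculus into exactness of a concrete form. -/
theorem fRep_fDiff_apply (u : Forms J) {v : V} (hv : d v = 0) :
    fRep ρ hJ hd h (fDiff J hJ u) v = d (fRep ρ hJ hd h u v) := by
  obtain ⟨u, rfl⟩ := quoMk_surjective _ u
  change fRep ρ hJ hd h (fDiff J hJ (fProj J u)) v = d (fRep ρ hJ hd h (fProj J u) v)
  rw [fDiff_fProj, fRep_fProj, fRep_fProj, (uDouble_shape ρ hd u).2.2]
  simp [hv]

end Representation

/-! ## Powers of the square root of `λ` -/

theorem contDiffOn_iccExtend (f : SmoothFn) :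
    ContDiffOn ℝ ∞ (Set.IccExtend (by norm_num : (-1 : ℝ) ≤ 1) f.1) (Set.Icc (-1) 1) := by
  obtain ⟨F, hF, hf⟩ := f.2
  exact hF.congr (fun s hs => by rw [Set.IccExtend_of_mem _ _ hs, hf])

theorem hasDerivWithinAt_derivFn (f : SmoothFn) (s : Set.Icc (-1 : ℝ) 1) :
    HasDerivWithinAt (Set.IccExtend (by norm_num : (-1 : ℝ) ≤ 1) f.1) ((derivFn f).1 s)
      (Set.Icc (-1) 1) s :=
  (((contDiffOn_iccExtend f).differentiableOn (by simp)) s s.2).hasDerivWithinAt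

theorem derivFn_eq_of_hasDerivWithinAt (f : SmoothFn) (F : ℝ → ℂ) (s : Set.Icc (-1 : ℝ) 1) (z : ℂ)
    (hf : ∀ s, f.1 s = F s) (hF : HasDerivWithinAt F z (Set.Icc (-1) 1) s) :
    (derivFn f).1 s = z := by
  have h : HasDerivWithinAt (Set.IccExtend (by norm_num : (-1 : ℝ) ≤ 1) f.1) z
      (Set.Icc (-1) 1) s :=
    hF.congr (fun u hu => by rw [Set.IccExtend_of_mem _ _ hu, hf])
      (by rw [Set.IccExtend_of_mem _ _ s.2, hf])
  exact h.derivWithin (uniqueDiffOn_Icc (by norm_num) s s.2)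

variable (φ : ℝ → ℝ) (hφ : ContDiffOn ℝ ∞ φ (Set.Icc (-1) 1))

/-- The function `λ^(n/2) = exp(-i n φ / 2)`. -/
def halfPow (n : ℤ) : SmoothFn :=
  ⟨fun s => Complex.exp ((n / 2 : ℂ) * -(Complex.I * (φ s : ℂ))),
    fun s => Complex.exp ((n / 2 : ℂ) * -(Complex.I * (φ s : ℂ))),
    (contDiffOn_const.mul
      (contDiffOn_const.mul (Complex.ofRealCLM.contDiff.comp_contDiffOn hφ)).neg).cexp,
    fun _ => rfl⟩

theorem halfPow_zero : halfPow φ hφ 0 = 1 := by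
  ext s
  simp [halfPow]

theorem halfPow_add (m n : ℤ) : halfPow φ hφ (m + n) = halfPow φ hφ m * halfPow φ hφ n := by
  ext s
  change Complex.exp _ = Complex.exp _ * Complex.exp _
  rw [← Complex.exp_add]
  push_cast
  ring_nf

theorem halfPow_two : halfPow φ hφ 2 = lam φ hφ := by
  ext s
  simp [halfPow, lam]

theorem conjFn_lam : conjFn (lam φ hφ) = halfPow φ hφ (-2) := by
  ext s
  simp [halfPow, lam, conjFn, ← Complex.exp_conj]

/-- The logarithmic derivative `λ'/λ`. -/
def logDeriv : SmoothFn := halfPow φ hφ (-2) * derivFn (halfPow φ hφ 2)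

theorem derivFn_halfPow_apply (n : ℤ) (s : Set.Icc (-1 : ℝ) 1) :
    (derivFn (halfPow φ hφ n)).1 s =
      (n / 2 : ℂ) * -(Complex.I * ((derivWithin φ (Set.Icc (-1) 1) s : ℝ) : ℂ)) *
        (halfPow φ hφ n).1 s := by
  have h0 : HasDerivWithinAt φ (derivWithin φ (Set.Icc (-1) 1) s) (Set.Icc (-1) 1) s :=
    ((hφ.differentiableOn (by simp)) s s.2).hasDerivWithinAt
  have h1 := (((h0.ofReal_comp.const_mul Complex.I).neg).const_mul (n / 2 : ℂ)).cexp
  refine (derivFn_eq_of_hasDerivWithinAt _ _ s _ (fun _ => rfl) h1).trans ?_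
  rw [mul_comm]
  rfl

/-- Comparing the exponents n and 2 eliminates φ′, so later computations stay inside the algebra of
smooth functions. -/
theorem derivFn_halfPow (n : ℤ) :
    derivFn (halfPow φ hφ n) = (n / 2 : ℂ) • (logDeriv φ hφ * halfPow φ hφ n) := by
  ext s
  have h : (halfPow φ hφ (-2)).1 s * (halfPow φ hφ 2).1 s = 1 := by
    have := congrArg (fun f : SmoothFn => f.1 s) (halfPow_add φ hφ (-2) 2)
    simpa [halfPow_zero] using this.symm
  rw [derivFn_halfPow_apply]
  change _ = (n / 2 : ℂ) * ((halfPow φ hφ (-2)).1 s * (derivFn (halfPow φ hφ 2)).1 s *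
    (halfPow φ hφ n).1 s)
  rw [derivFn_halfPow_apply]
  push_cast
  linear_combination (-(n / 2 : ℂ) * -(Complex.I * ((derivWithin φ (Set.Icc (-1) 1) s : ℝ) : ℂ)) *
    (halfPow φ hφ n).1 s) * h

/-! ## Weights -/

/-- The weights of `a, a*, b, b*` under the action of the two-torus. -/
def weight : Fin 4 → ℤ × ℤ := ![(1, 0), (-1, 0), (0, 1), (0, -1)]

/-- The antisymmetric pairing of weights. -/
def weightPair (w m : ℤ × ℤ) : ℤ := w.1 * m.2 - w.2 * m.1

theorem commA_lam (i j : Fin 4) :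
    commA (lam φ hφ) i j = halfPow φ hφ (2 * weightPair (weight i) (weight j)) := by
  fin_cases i <;> fin_cases j <;>
    simp [commA, weightPair, weight, halfPow_zero, halfPow_two, conjFn_lam]

theorem commB_lam (i j : Fin 4) :
    commB (lam φ hφ) i j = (weightPair (weight i) (weight j) : ℂ) • logDeriv φ hφ := by
  have h : conjFn (halfPow φ hφ (2 * weightPair (weight i) (weight j))) =
      halfPow φ hφ (-(2 * weightPair (weight i) (weight j))) := by
    ext s
    simp only [conjFn, halfPow, ← Complex.exp_conj]
    simp
    ring_nf
  rw [commB, commA_lam, h, derivFn_halfPow, mul_smul_comm, mul_left_comm, ← halfPow_add,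
    neg_add_cancel, halfPow_zero, mul_one]
  push_cast
  congr 1
  ring

/-! ## The twisted representation -/

section Twist

variable {R : Type} [CommRing R] [Algebra ℂ R]
  {M : Type} [AddCommGroup M] [Module ℂ M] [Module R M] [IsScalarTower ℂ R M]

/-- The operator that shifts the label by `w` and multiplies by a coefficient depending on the
label. -/
def shiftOp (M : Type) [AddCommGroup M] [Module ℂ M] [Module R M] [IsScalarTower ℂ R M]
    (w : ℤ × ℤ) (r : ℤ × ℤ → R) : Module.End ℂ (ℤ × ℤ →₀ M) :=
  Finsupp.lsum ℂ (fun m => Finsupp.lsingle (m + w) ∘ₗ Algebra.lsmul ℂ ℂ M (r m))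

@[simp]
theorem shiftOp_single (w m : ℤ × ℤ) (r : ℤ × ℤ → R) (v : M) :
    shiftOp M w r (Finsupp.single m v) = Finsupp.single (m + w) (r m • v) := by
  simp [shiftOp]

variable (F : SmoothFn →ₐ[ℂ] R) (y : Fin 4 → R)

/-- The action of the generators of the deformed sphere. -/
def twistLetter (M : Type) [AddCommGroup M] [Module ℂ M] [Module R M] [IsScalarTower ℂ R M] :
    SphereLetter → Module.End ℂ (ℤ × ℤ →₀ M)
  | .x i => shiftOp M (weight i) (fun m => F (halfPow φ hφ (weightPair (weight i) m)) * y i)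
  | .fn f => shiftOp M 0 (fun _ => F f)

/-- The representation of the deformed sphere by weighted multiplication operators. -/
def twistRep (hy : y 0 * y 1 + y 2 * y 3 + F coordFn ^ 2 = 1)
    (M : Type) [AddCommGroup M] [Module ℂ M] [Module R M] [IsScalarTower ℂ R M] :
    DefSphere (lam φ hφ) →ₐ[ℂ] Module.End ℂ (ℤ × ℤ →₀ M) :=
  quoLift _ (FreeAlgebra.lift ℂ (twistLetter φ hφ F y M)) (by
    intro u v h
    refine Finsupp.lhom_ext fun m z => ?_
    induction h with
    | fn_scalar c =>
      simp [twistLetter, Module.algebraMap_end_apply, Finsupp.smul_single]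
    | fn_add f g => simp [twistLetter, add_smul]
    | fn_mul f g => simp [twistLetter, mul_smul]
    | central f i =>
      simp only [map_mul, FreeAlgebra.lift_ι_apply, twistLetter, Module.End.mul_apply,
        shiftOp_single, add_zero, smul_smul]
      congr 2
      ring
    | comm i j =>
      simp only [map_mul, FreeAlgebra.lift_ι_apply, twistLetter, Module.End.mul_apply,
        shiftOp_single, add_zero, smul_smul, commA_lam]
      -- The two orders of a product carry opposite half exponents ±⟨wᵢ,wⱼ⟩/2 besides a common
      -- phase. Their quotient is the full power Aᵢⱼ.
      have h : halfPow φ hφ (weightPair (weight i) (m + weight j)) *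
          halfPow φ hφ (weightPair (weight j) m) =
          halfPow φ hφ (2 * weightPair (weight i) (weight j)) *
          (halfPow φ hφ (weightPair (weight j) (m + weight i)) *
          halfPow φ hφ (weightPair (weight i) m)) := by
        rw [← halfPow_add, ← halfPow_add, ← halfPow_add]
        congr 1
        simp only [weightPair, Prod.fst_add, Prod.snd_add]
        ring
      have h' := congrArg F h
      simp only [map_mul] at h'
      rw [add_right_comm]
      congr 2
      linear_combination (y i * y j) * h'
    | sphere =>
      -- A generator and its adjoint have opposite weights, so their phases cancel and the classical
      -- sphere equation `hy` remains.
      have h0 : ∀ i j, weight i = -weight j → weightPair (weight i) (m + weight j) +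
          weightPair (weight j) m = 0 := by
        intro i j h
        simp only [h, weightPair, Prod.fst_add, Prod.snd_add, Prod.fst_neg, Prod.snd_neg]
        ring
      have h : ∀ i j, weight i = - weight j →
          (F (halfPow φ hφ (weightPair (weight i) (m + weight j))) * y i) *
          (F (halfPow φ hφ (weightPair (weight j) m)) * y j) = y i * y j := by
        intro i j hij
        have := halfPow_add φ hφ (weightPair (weight i) (m + weight j)) (weightPair (weight j) m)
        rw [h0 i j hij, halfPow_zero] at this
        have h' := congrArg F this
        rw [map_one, map_mul] at h'
        linear_combination -(y i * y j) * h'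
      have e01 : weight 0 = - weight 1 := rfl
      have e23 : weight 2 = - weight 3 := rfl
      simp only [map_mul, map_add, map_one, FreeAlgebra.lift_ι_apply, twistLetter,
        Module.End.mul_apply, LinearMap.add_apply, Module.End.one_apply, pow_two,
        shiftOp_single, add_zero, smul_smul, h 0 1 e01, h 2 3 e23]
      rw [e01, e23, add_neg_cancel_right, add_neg_cancel_right, ← Finsupp.single_add,
        ← Finsupp.single_add, ← add_smul, ← add_smul, ← pow_two, hy, one_smul])

variable (hy : y 0 * y 1 + y 2 * y 3 + F coordFn ^ 2 = 1)

theorem twistRep_gen (i : Fin 4) (m : ℤ × ℤ) (v : M) :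
    twistRep φ hφ F y hy M (gen _ i) (Finsupp.single m v) =
      Finsupp.single (m + weight i) ((F (halfPow φ hφ (weightPair (weight i) m)) * y i) • v) := by
  rw [gen, twistRep, quoLift_mk, FreeAlgebra.lift_ι_apply, twistLetter, shiftOp_single]

theorem twistRep_fnT (f : SmoothFn) (m : ℤ × ℤ) (v : M) :
    twistRep φ hφ F y hy M (fnT _ f) (Finsupp.single m v) = Finsupp.single m (F f • v) := by
  rw [fnT, twistRep, quoLift_mk, FreeAlgebra.lift_ι_apply, twistLetter, shiftOp_single, add_zero]

end Twist

/-! ## Forms with coefficients in a ring with five commuting derivations -/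

section Forms

open scoped TensorProduct

/-- The exterior algebra on five generators. -/
abbrev Ext5 : Type := ExteriorAlgebra ℂ (Fin 5 → ℂ)

/-- The generators of the exterior algebra. -/
def extGen (k : Fin 5) : Ext5 := ExteriorAlgebra.ι ℂ (Pi.single k 1)

theorem extGen_mul_self (k : Fin 5) : extGen k * extGen k = 0 :=
  ExteriorAlgebra.ι_sq_zero _

theorem extGen_mul_comm (k l : Fin 5) : extGen k * extGen l = -(extGen l * extGen k) :=
  eq_neg_of_add_eq_zero_left (ExteriorAlgebra.ι_add_mul_swap _ _)

variable {R : Type} [CommRing R] [Algebra ℂ R] (D : Fin 5 → Derivation ℂ R R)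

/-- The exterior derivative. -/
def extD : Module.End ℂ (R ⊗[ℂ] Ext5) :=
  ∑ k, TensorProduct.map (D k : R →ₗ[ℂ] R) (LinearMap.mulLeft ℂ (extGen k))

/-- The differential of an element of the coefficient ring. -/
def grad : R →ₗ[ℂ] R ⊗[ℂ] Ext5 :=
  ∑ k, ((TensorProduct.mk ℂ R Ext5).flip (extGen k)) ∘ₗ (D k : R →ₗ[ℂ] R)

theorem grad_apply (r : R) : grad D r = ∑ k, D k r ⊗ₜ[ℂ] extGen k := by
  simp [grad]

theorem extD_tmul (r : R) (v : Ext5) :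
    extD D (r ⊗ₜ v) = ∑ k, D k r ⊗ₜ[ℂ] (extGen k * v) := by
  simp [extD]

theorem grad_mul (r s : R) : grad D (r * s) = r • grad D s + s • grad D r := by
  simp only [grad_apply, Finset.smul_sum, ← Finset.sum_add_distrib, Derivation.leibniz,
    TensorProduct.add_tmul, TensorProduct.smul_tmul']

theorem grad_one : grad D 1 = 0 := by
  simp [grad_apply]

theorem extD_smul (r : R) (v : R ⊗[ℂ] Ext5) :
    extD D (r • v) = grad D r * v + r • extD D v := by
  induction v with
  | zero => simp
  | tmul s v =>
    rw [TensorProduct.smul_tmul', extD_tmul, extD_tmul, grad_apply, Finset.sum_mul,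
      Finset.smul_sum, ← Finset.sum_add_distrib]
    refine Finset.sum_congr rfl fun k _ => ?_
    rw [Algebra.TensorProduct.tmul_mul_tmul, TensorProduct.smul_tmul', smul_eq_mul,
      Derivation.leibniz, TensorProduct.add_tmul, add_comm, smul_eq_mul, smul_eq_mul,
      mul_comm s]
  | add v w hv hw => rw [smul_add, map_add, hv, hw, map_add, mul_add, smul_add]; abel

theorem extD_one : extD D (1 : R ⊗[ℂ] Ext5) = 0 := by
  simp [Algebra.TensorProduct.one_def, extD_tmul]

/-- Exchanging the indices shows that the sum equals its own negative. This is the common mechanism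
behind d² = 0, n∧n = 0 and the vanishing of integrals of exact forms. -/
theorem sum_antisymm_eq_zero {M : Type} [AddCommGroup M] [Module ℂ M] (f : Fin 5 → Fin 5 → M)
    (hf : ∀ k l, f k l = -f l k) : ∑ k, ∑ l, f k l = 0 := by
  have h : ∑ k, ∑ l, f k l = -∑ k, ∑ l, f k l := by
    conv_lhs => rw [Finset.sum_comm]
    simp only [← Finset.sum_neg_distrib]
    exact Finset.sum_congr rfl fun k _ => Finset.sum_congr rfl fun l _ => hf l k
  have h2 : (2 : ℂ) • ∑ k, ∑ l, f k l = 0 := by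
    rw [two_smul]
    nth_rewrite 2 [h]
    exact add_neg_cancel _
  exact (smul_eq_zero.mp h2).resolve_left two_ne_zero

theorem extD_mul_self (hD : ∀ k l r, D k (D l r) = D l (D k r)) : extD D * extD D = 0 := by
  refine TensorProduct.ext' fun r v => ?_
  rw [Module.End.mul_apply, extD_tmul, map_sum]
  simp only [extD_tmul]
  refine sum_antisymm_eq_zero _ fun k l => ?_
  rw [hD l k, ← mul_assoc, ← mul_assoc, extGen_mul_comm l k, neg_mul, TensorProduct.tmul_neg]

theorem grad_mul_swap (r s : R) : grad D r * grad D s = -(grad D s * grad D r) := by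
  simp only [grad_apply, Finset.sum_mul_sum, Algebra.TensorProduct.tmul_mul_tmul,
    ← Finset.sum_neg_distrib]
  rw [Finset.sum_comm]
  refine Finset.sum_congr rfl fun k _ => Finset.sum_congr rfl fun l _ => ?_
  rw [extGen_mul_comm l k, TensorProduct.tmul_neg, mul_comm]

/-- The exterior derivative on labelled forms. -/
def labD : Module.End ℂ (ℤ × ℤ →₀ R ⊗[ℂ] Ext5) := Finsupp.mapRange.linearMap (extD D)

theorem labD_single (m : ℤ × ℤ) (v : R ⊗[ℂ] Ext5) :
    labD D (Finsupp.single m v) = Finsupp.single m (extD D v) := by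
  simp [labD]

theorem labD_mul_self (hD : ∀ k l r, D k (D l r) = D l (D k r)) : labD D * labD D = 0 := by
  refine Finsupp.lhom_ext fun m v => ?_
  rw [Module.End.mul_apply, labD_single, labD_single, ← Module.End.mul_apply, extD_mul_self D hD]
  simp

/-- The complex coordinates `a, a*, b, b*` formed from real coordinates. -/
def complexCoord {R : Type} [CommRing R] [Algebra ℂ R] (y : Fin 5 → R) : Fin 4 → R :=
  ![y 0 + Complex.I • y 1, y 0 - Complex.I • y 1, y 2 + Complex.I • y 3, y 2 - Complex.I • y 3]

variable (φ : ℝ → ℝ) (hφ : ContDiffOn ℝ ∞ φ (Set.Icc (-1) 1)) (F : SmoothFn →ₐ[ℂ] R)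
  (y : Fin 4 → R) (hy : y 0 * y 1 + y 2 * y 3 + F coordFn ^ 2 = 1)

/-- The action of forms on labelled forms. -/
abbrev formOp : UnivForms (DefSphere (lam φ hφ)) →ₐ[ℂ] Module.End ℂ (ℤ × ℤ →₀ R ⊗[ℂ] Ext5) :=
  uRep (labD D) (twistRep φ hφ F y hy (R ⊗[ℂ] Ext5))

/-- The terms containing dv cancel in the commutator. What is left is exterior multiplication by the
differential of the whole coefficient, phase included. -/
theorem formOp_uD_gen (i : Fin 4) (m : ℤ × ℤ) (v : R ⊗[ℂ] Ext5) :
    formOp D φ hφ F y hy (uD _ (gen _ i)) (Finsupp.single m v) =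
      Finsupp.single (m + weight i)
        (grad D (F (halfPow φ hφ (weightPair (weight i) m)) * y i) * v) := by
  simp only [uRep_uD, LinearMap.sub_apply, Module.End.mul_apply, labD_single, twistRep_gen,
    extD_smul, ← Finsupp.single_sub, add_sub_cancel_right]

theorem formOp_uD_fnT (f : SmoothFn) (m : ℤ × ℤ) (v : R ⊗[ℂ] Ext5) :
    formOp D φ hφ F y hy (uD _ (fnT _ f)) (Finsupp.single m v) =
      Finsupp.single m (grad D (F f) * v) := by
  simp only [uRep_uD, LinearMap.sub_apply, Module.End.mul_apply, labD_single, twistRep_fnT,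
    extD_smul, ← Finsupp.single_sub, add_sub_cancel_right]

theorem formOp_uEl_gen (i : Fin 4) (m : ℤ × ℤ) (v : R ⊗[ℂ] Ext5) :
    formOp D φ hφ F y hy (uEl _ (gen _ i)) (Finsupp.single m v) =
      Finsupp.single (m + weight i) ((F (halfPow φ hφ (weightPair (weight i) m)) * y i) • v) := by
  rw [uRep_uEl, twistRep_gen]

theorem formOp_uEl_fnT (f : SmoothFn) (m : ℤ × ℤ) (v : R ⊗[ℂ] Ext5) :
    formOp D φ hφ F y hy (uEl _ (fnT _ f)) (Finsupp.single m v) =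
      Finsupp.single m (F f • v) := by
  rw [uRep_uEl, twistRep_fnT]

theorem map_halfPow_eq_mul {p q r : ℤ} (h : p = q + r) :
    F (halfPow φ hφ p) = F (halfPow φ hφ q) * F (halfPow φ hφ r) := by
  rw [h, halfPow_add, map_mul]

theorem grad_halfPow_mul
    (hF : ∀ f, grad D (F f) = F (derivFn f) • grad D (F coordFn)) (n : ℤ) (r : R) :
    grad D (F (halfPow φ hφ n) * r) = F (halfPow φ hφ n) •
      (grad D r + ((n / 2 : ℂ) • (F (logDeriv φ hφ) * r)) • grad D (F coordFn)) := by
  rw [grad_mul, hF, derivFn_halfPow, map_smul, map_mul, smul_add, smul_smul, smul_smul]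
  congr 2
  simp only [Algebra.smul_def]
  ring

/-- It is enough to test on one label at a time. The relations `comm` and `sphere` carry the
content; the others follow from the chain rule `hF` and from scalars commuting with forms. -/
theorem formOp_oneFormRels (hF : ∀ f, grad D (F f) = F (derivFn f) • grad D (F coordFn))
    (j : UnivForms (DefSphere (lam φ hφ))) (hj : j ∈ oneFormRels (lam φ hφ)) :
    formOp D φ hφ F y hy j = 0 := by
  refine Finsupp.lhom_ext fun m v => ?_
  induction (show OneFormRel _ j from hj) with
  | chain f =>
    simp only [map_sub, map_mul, LinearMap.sub_apply, Module.End.mul_apply, tEl, formOp_uD_fnT,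
      formOp_uEl_fnT, ← Finsupp.single_sub, LinearMap.zero_apply]
    rw [hF f, smul_mul_assoc, sub_self, Finsupp.single_zero]
  | dt_gen i =>
    simp only [map_sub, map_mul, LinearMap.sub_apply, Module.End.mul_apply, tEl, formOp_uD_fnT,
      formOp_uEl_gen, ← Finsupp.single_sub, LinearMap.zero_apply]
    rw [mul_smul_comm, sub_self, Finsupp.single_zero]
  | dt_fn f =>
    simp only [map_sub, map_mul, LinearMap.sub_apply, Module.End.mul_apply, tEl, formOp_uD_fnT,
      formOp_uEl_fnT, ← Finsupp.single_sub, LinearMap.zero_apply]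
    rw [mul_smul_comm, sub_self, Finsupp.single_zero]
  | fn_dgen f i =>
    simp only [map_sub, map_mul, LinearMap.sub_apply, Module.End.mul_apply, formOp_uD_gen,
      formOp_uEl_fnT, ← Finsupp.single_sub, LinearMap.zero_apply]
    rw [mul_smul_comm, sub_self, Finsupp.single_zero]
  | comm i j =>
    simp only [map_sub, map_add, map_mul, map_smul, LinearMap.sub_apply, LinearMap.add_apply,
      LinearMap.smul_apply, Module.End.mul_apply, tEl, formOp_uD_gen, formOp_uD_fnT,
      formOp_uEl_gen, formOp_uEl_fnT, LinearMap.zero_apply, commA_lam, commB_lam,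
      add_right_comm m (weight i) (weight j), Finsupp.smul_single, ← Finsupp.single_add,
      ← Finsupp.single_sub]
    -- The differentiated phase has exponent ⟨wⱼ,m⟩ in xⁱdxʲ, but ⟨wⱼ,m⟩ − ⟨wᵢ,wⱼ⟩ in dxʲxⁱ, both in
    -- half powers. The discrepancy ½⟨wᵢ,wⱼ⟩ λ′/λ is what the ½B term supplies.
    have h1 := map_halfPow_eq_mul φ hφ F
      (p := weightPair (weight i) (m + weight j))
      (q := weightPair (weight i) (weight j)) (r := weightPair (weight i) m) (by
        simp only [weightPair, Prod.fst_add, Prod.snd_add]; ring)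
    have h2 := map_halfPow_eq_mul φ hφ F (p := weightPair (weight i) (weight j))
      (q := 2 * weightPair (weight i) (weight j))
      (r := -weightPair (weight i) (weight j)) (by ring)
    have h3 : weightPair (weight j) (m + weight i) =
        weightPair (weight j) m - weightPair (weight i) (weight j) := by
      simp only [weightPair, Prod.fst_add, Prod.snd_add]; ring
    have h4 := map_halfPow_eq_mul φ hφ F (p := weightPair (weight j) (m + weight i))
      (q := -weightPair (weight i) (weight j)) (r := weightPair (weight j) m) (by
        rw [h3]; ring)
    rw [grad_halfPow_mul D φ hφ F hF, grad_halfPow_mul D φ hφ F hF, h3]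
    rw [h3] at h4
    rw [h1, h4]
    simp only [← algebraMap_smul R (_ : ℂ) (_ : R ⊗[ℂ] Ext5), smul_add, mul_smul_comm,
      smul_mul_assoc, add_mul, Algebra.smul_def (_ : ℂ) (_ : R)]
    refine (congrArg (Finsupp.single _) ?_).trans (Finsupp.single_zero _)
    simp only [div_eq_mul_inv, one_mul, Int.cast_sub, map_sub, map_mul]
    generalize grad D (y j) * v = P
    generalize grad D (F coordFn) * v = Q
    -- The coefficients of dyⱼ and of dt are compared separately; with p = ⟨wᵢ,wⱼ⟩, both reduce to
    -- λ^(p/2) = λ^p λ^(−p/2).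
    match_scalars
    · linear_combination (F (halfPow φ hφ (weightPair (weight i) m)) * y i *
        F (halfPow φ hφ (weightPair (weight j) m))) * h2
    · linear_combination (F (halfPow φ hφ (weightPair (weight i) m)) * y i *
        F (halfPow φ hφ (weightPair (weight j) m)) * algebraMap ℂ R 2⁻¹ * y j *
        (algebraMap ℂ R (weightPair (weight j) m) -
          algebraMap ℂ R (weightPair (weight i) (weight j))) * F (logDeriv φ hφ)) * h2
  | sphere =>
    have h : ∀ i j, weight i = -weight j →
        (F (halfPow φ hφ (weightPair (weight i) (m + weight j))) * y i) •
          (grad D (F (halfPow φ hφ (weightPair (weight j) m)) * y j) * v) =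
        (y i • grad D (y j) + ((weightPair (weight j) m / 2 : ℂ) •
          (F (logDeriv φ hφ) * (y i * y j))) • grad D (F coordFn)) * v := by
      intro i j hij
      have h1 := map_halfPow_eq_mul φ hφ F (p := 0)
        (q := weightPair (weight i) (m + weight j)) (r := weightPair (weight j) m) (by
          simp only [hij, weightPair, Prod.fst_add, Prod.snd_add, Prod.fst_neg, Prod.snd_neg]
          ring)
      rw [halfPow_zero, map_one] at h1
      rw [grad_halfPow_mul D φ hφ F hF, ← smul_mul_assoc, smul_smul, mul_right_comm, ← h1, one_mul,
        smul_add, smul_smul, mul_smul_comm, mul_left_comm]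
    -- The logarithmic derivatives in x dx* and x* dx have opposite coefficients and cancel.
    have hneg : ∀ i j, weight i = -weight j →
        (weightPair (weight i) m : ℂ) = -(weightPair (weight j) m : ℂ) := by
      intro i j hij
      rw [hij]
      simp only [weightPair, Prod.fst_neg, Prod.snd_neg]
      push_cast
      ring
    have e01 : weight 0 = -weight 1 := rfl
    have e10 : weight 1 = -weight 0 := rfl
    have e23 : weight 2 = -weight 3 := rfl
    have e32 : weight 3 = -weight 2 := rfl
    have hm : ∀ i j, weight i = -weight j → m + weight i + weight j = m := by
      intro i j hij
      rw [hij, neg_add_cancel_right]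
    -- After this cancellation the relation is the differential of the classical sphere equation.
    have hg := congrArg (fun r => grad D r * v) hy
    simp only [grad_one, zero_mul, map_add, pow_two, grad_mul] at hg
    simp only [map_add, map_mul, map_smul, LinearMap.add_apply,
      LinearMap.smul_apply, Module.End.mul_apply, tEl, formOp_uD_gen, formOp_uD_fnT,
      formOp_uEl_gen, formOp_uEl_fnT, LinearMap.zero_apply, Finsupp.smul_single,
      h 0 1 e01, h 1 0 e10, h 2 3 e23, h 3 2 e32, hm 0 1 e01, hm 1 0 e10, hm 2 3 e23, hm 3 2 e32,
      ← Finsupp.single_add, hneg 0 1 e01, hneg 2 3 e23]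
    refine (congrArg (Finsupp.single _) ?_).trans (Finsupp.single_zero _)
    rw [← hg, ← smul_mul_assoc (F coordFn), ← smul_mul_assoc (2 : ℂ), ← add_mul, ← add_mul,
      ← add_mul, ← add_mul]
    congr 1
    simp only [Algebra.smul_def (_ : ℂ) (_ : R), two_smul, div_eq_mul_inv, map_mul,
      map_neg]
    module

end Forms

/-! ## Smooth functions on the punctured space -/

section Punctured

open Topology

/-- The Euclidean space that contains the sphere. -/
abbrev E5 : Type := EuclideanSpace ℝ (Fin 5)

/-- The space without the origin. -/
abbrev Punct : Type := {x : E5 // x ∈ ({0}ᶜ : Set E5)}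

/-- The algebra of smooth complex functions on the punctured space. -/
def PunctFn : Subalgebra ℂ (Punct → ℂ) where
  carrier := {g | ∃ G : E5 → ℂ, ContDiffOn ℝ ∞ G {0}ᶜ ∧ ∀ u : Punct, g u = G u}
  mul_mem' := by
    rintro f g ⟨F, hF, hf⟩ ⟨G, hG, hg⟩
    exact ⟨fun s => F s * G s, hF.mul hG, fun s => by simp [hf, hg]⟩
  add_mem' := by
    rintro f g ⟨F, hF, hf⟩ ⟨G, hG, hg⟩
    exact ⟨fun s => F s + G s, hF.add hG, fun s => by simp [hf, hg]⟩
  algebraMap_mem' := fun c => ⟨fun _ => c, contDiffOn_const, fun _ => rfl⟩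

/-- A smooth extension, up to its value at the origin. -/
def punctExt (g : PunctFn) : E5 → ℂ := g.2.choose

theorem contDiffOn_punctExt (g : PunctFn) : ContDiffOn ℝ ∞ (punctExt g) {0}ᶜ :=
  g.2.choose_spec.1

theorem punctExt_apply (g : PunctFn) (u : Punct) : punctExt g u = g.1 u :=
  (g.2.choose_spec.2 u).symm

theorem punct_nhds (u : Punct) : ({0}ᶜ : Set E5) ∈ 𝓝 (u : E5) :=
  isOpen_compl_singleton.mem_nhds u.2

theorem contDiffAt_punctExt (g : PunctFn) (u : Punct) : ContDiffAt ℝ ∞ (punctExt g) u :=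
  (contDiffOn_punctExt g).contDiffAt (punct_nhds u)

theorem hasFDerivAt_punctExt (g : PunctFn) (u : Punct) :
    HasFDerivAt (punctExt g) (fderiv ℝ (punctExt g) u) u :=
  ((contDiffAt_punctExt g u).differentiableAt (by simp)).hasFDerivAt

theorem punctExt_eventuallyEq (g : PunctFn) (u : Punct) (G : E5 → ℂ)
    (h : ∀ u : Punct, g.1 u = G u) : punctExt g =ᶠ[𝓝 (u : E5)] G := by
  filter_upwards [punct_nhds u] with x hx
  rw [punctExt_apply g ⟨x, hx⟩, h]

/-- Away from the origin the derivative depends only on the germ, so the chosen extension may be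
replaced by any convenient one. -/
theorem fderiv_punctExt_eq (g : PunctFn) (u : Punct) (G : E5 → ℂ) (G' : E5 →L[ℝ] ℂ)
    (h : ∀ u : Punct, g.1 u = G u) (hG : HasFDerivAt G G' u) :
    fderiv ℝ (punctExt g) u = G' :=
  (hG.congr_of_eventuallyEq (punctExt_eventuallyEq g u G h)).fderiv

/-- The partial derivatives. -/
def partialD (k : Fin 5) : Derivation ℂ PunctFn PunctFn :=
  Derivation.mk'
    { toFun := fun g => ⟨fun u => fderiv ℝ (punctExt g) u (EuclideanSpace.single k 1),
        fun x => fderiv ℝ (punctExt g) x (EuclideanSpace.single k 1),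
        (((contDiffOn_infty_iff_fderiv_of_isOpen isOpen_compl_singleton).mp
          (contDiffOn_punctExt g)).2).clm_apply contDiffOn_const, fun _ => rfl⟩
      map_add' := fun f g => by
        ext u
        change fderiv ℝ (punctExt (f + g)) u _ = fderiv ℝ (punctExt f) u _ +
          fderiv ℝ (punctExt g) u _
        rw [fderiv_punctExt_eq (f + g) u (fun x => punctExt f x + punctExt g x) _
          (fun u => by rw [punctExt_apply, punctExt_apply]; rfl)
          ((hasFDerivAt_punctExt f u).add (hasFDerivAt_punctExt g u))]
        rfl
      map_smul' := fun c g => by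
        ext u
        change fderiv ℝ (punctExt (c • g)) u _ = c * fderiv ℝ (punctExt g) u _
        rw [fderiv_punctExt_eq (c • g) u (fun x => c • punctExt g x) _
          (fun u => by rw [punctExt_apply]; rfl)
          ((hasFDerivAt_punctExt g u).const_smul c)]
        rfl }
    (fun f g => by
      ext u
      change fderiv ℝ (punctExt (f * g)) u _ = f.1 u * fderiv ℝ (punctExt g) u _ +
        g.1 u * fderiv ℝ (punctExt f) u _
      rw [fderiv_punctExt_eq (f * g) u (fun x => punctExt f x * punctExt g x) _
        (fun u => by rw [punctExt_apply, punctExt_apply]; rfl)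
        ((hasFDerivAt_punctExt f u).mul (hasFDerivAt_punctExt g u))]
      simp [punctExt_apply])

theorem partialD_apply (k : Fin 5) (g : PunctFn) (u : Punct) :
    (partialD k g).1 u = fderiv ℝ (punctExt g) u (EuclideanSpace.single k 1) :=
  rfl

theorem partialD_apply_eq (k : Fin 5) (g : PunctFn) (u : Punct) (G : E5 → ℂ) (G' : E5 →L[ℝ] ℂ)
    (h : ∀ u : Punct, g.1 u = G u) (hG : HasFDerivAt G G' u) :
    (partialD k g).1 u = G' (EuclideanSpace.single k 1) := by
  rw [partialD_apply, fderiv_punctExt_eq g u G G' h hG]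

theorem partialD_comm (k l : Fin 5) (g : PunctFn) :
    partialD k (partialD l g) = partialD l (partialD k g) := by
  ext u
  have h2 : DifferentiableAt ℝ (fderiv ℝ (punctExt g)) u :=
    ((contDiffAt_punctExt g u).fderiv_right (m := 1)
      (WithTop.coe_le_coe.mpr le_top)).differentiableAt (by simp)
  have h : ∀ i j, (partialD i (partialD j g)).1 u =
      fderiv ℝ (fderiv ℝ (punctExt g)) u (EuclideanSpace.single i 1)
        (EuclideanSpace.single j 1) := by
    intro i j
    rw [partialD_apply_eq i (partialD j g) u
      (fun x => fderiv ℝ (punctExt g) x (EuclideanSpace.single j 1)) _ (fun _ => rfl)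
      (h2.hasFDerivAt.clm_apply (hasFDerivAt_const _ _))]
    simp
  rw [h, h]
  exact (contDiffAt_punctExt g u).isSymmSndFDerivAt
    (by rw [minSmoothness_of_isRCLikeNormedField]; exact WithTop.coe_le_coe.mpr le_top) _ _

/-! ### Linear coordinates and their normalisations of degree zero -/

/-- The linear coordinates. -/
def linCoord (k : Fin 5) : PunctFn :=
  ⟨fun u => ((u.1 k : ℝ) : ℂ), fun x => ((x k : ℝ) : ℂ),
    (Complex.ofRealCLM.contDiff.comp
      (EuclideanSpace.proj k : E5 →L[ℝ] ℝ).contDiff).contDiffOn,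
    fun _ => rfl⟩

theorem partialD_linCoord (k l : Fin 5) : partialD l (linCoord k) = if k = l then 1 else 0 := by
  ext u
  rw [partialD_apply_eq l (linCoord k) u _ _ (fun _ => rfl)
    (Complex.ofRealCLM.hasFDerivAt.comp _
      (EuclideanSpace.proj k : E5 →L[ℝ] ℝ).hasFDerivAt)]
  split_ifs with h <;> simp [h]

/-- The inverse of the radius. -/
def invNorm : PunctFn :=
  ⟨fun u => ((‖u.1‖⁻¹ : ℝ) : ℂ), fun x => ((‖x‖⁻¹ : ℝ) : ℂ),
    Complex.ofRealCLM.contDiff.comp_contDiffOn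
      ((contDiffOn_id.norm ℝ (fun _ hx => hx)).inv (fun _ hx => norm_ne_zero_iff.mpr hx)),
    fun _ => rfl⟩

theorem invNorm_sq_mul : invNorm ^ 2 * ∑ k, linCoord k ^ 2 = 1 := by
  ext u
  have h : ∑ k, (u.1 k) ^ 2 = ‖u.1‖ ^ 2 := by
    rw [EuclideanSpace.norm_sq_eq]
    simp
  have h0 : ‖u.1‖ ≠ 0 := norm_ne_zero_iff.mpr u.2
  have e : (((∑ k, linCoord k ^ 2 : PunctFn) : Punct → ℂ) u) =
      ((∑ k, (u.1 k) ^ 2 : ℝ) : ℂ) := by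
    simp [linCoord, Finset.sum_apply]
  change ((‖u.1‖⁻¹ : ℝ) : ℂ) ^ 2 * (((∑ k, linCoord k ^ 2 : PunctFn) : Punct → ℂ) u) = 1
  rw [e, h]
  norm_cast
  field_simp

/-- The restrictions of the linear coordinates to the sphere, extended along the rays. -/
def normCoord (k : Fin 5) : PunctFn := invNorm * linCoord k

/-- This holds on all of the punctured space. The linear coordinates satisfy it only on the sphere,
and there it could not be differentiated in normal directions. -/
theorem sum_normCoord_sq : ∑ k, normCoord k ^ 2 = 1 := by
  rw [← invNorm_sq_mul, Finset.mul_sum]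
  exact Finset.sum_congr rfl fun k _ => mul_pow _ _ _

/-- Differentiating ρ²∑xₖ² = 1 gives a linear equation for ∂ₗρ, which is then solved algebraically.
-/
theorem partialD_invNorm (l : Fin 5) :
    partialD l invNorm = -(invNorm ^ 2 * normCoord l) := by
  have h := congrArg (partialD l) invNorm_sq_mul
  have hs : partialD l (∑ k, linCoord k ^ 2) = 2 * linCoord l := by
    simp only [map_sum, Derivation.leibniz_pow, partialD_linCoord]
    simp [two_mul]
  rw [Derivation.leibniz, hs, Derivation.leibniz_pow, Derivation.map_one_eq_zero] at h
  simp only [smul_eq_mul, nsmul_eq_mul, Nat.cast_ofNat, Nat.add_one_sub_one, pow_one] at h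
  have h2 : (2 : PunctFn) * (partialD l invNorm + invNorm ^ 2 * normCoord l) = 0 := by
    rw [normCoord]
    linear_combination invNorm * h - 2 * partialD l invNorm * invNorm_sq_mul
  have h3 : (2 : ℂ) • (partialD l invNorm + invNorm ^ 2 * normCoord l) = 0 := by
    rw [← h2, two_smul, two_mul]
  exact eq_neg_of_add_eq_zero_left ((smul_eq_zero.mp h3).resolve_left two_ne_zero)

theorem partialD_normCoord (k l : Fin 5) :
    partialD l (normCoord k) =
      invNorm * ((if k = l then 1 else 0) - normCoord l * normCoord k) := by
  simp only [normCoord, Derivation.leibniz, partialD_invNorm, partialD_linCoord, smul_eq_mul]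
  ring

/-- The origin is included, since 0⁻¹ = 0 gives it height 0. The height thus never leaves the
interval. -/
theorem normHeight_mem (u : E5) : ‖u‖⁻¹ * u 4 ∈ Set.Icc (-1 : ℝ) 1 := by
  have h := PiLp.norm_apply_le u 4
  rw [Real.norm_eq_abs] at h
  rw [Set.mem_Icc, ← abs_le, abs_mul, abs_inv, abs_norm, inv_mul_eq_div]
  exact div_le_one_of_le₀ h (norm_nonneg _)

theorem contDiffOn_normHeight :
    ContDiffOn ℝ ∞ (fun u : E5 => ‖u‖⁻¹ * u 4) {0}ᶜ :=
  ((contDiffOn_id.norm ℝ (fun _ hx => hx)).inv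
    (fun x (hx : x ≠ 0) => norm_ne_zero_iff.mpr hx)).mul
    (EuclideanSpace.proj 4 : E5 →L[ℝ] ℝ).contDiff.contDiffOn

/-- Functions of the height, extended along the rays. -/
def heightFn : SmoothFn →ₐ[ℂ] PunctFn where
  toFun f := ⟨fun u => f.1 ⟨‖u.1‖⁻¹ * u.1 4, normHeight_mem u.1⟩,
    fun u => Set.IccExtend (by norm_num : (-1 : ℝ) ≤ 1) f.1 (‖u‖⁻¹ * u 4),
    (contDiffOn_iccExtend f).comp contDiffOn_normHeight (fun u _ => normHeight_mem u),
    fun u => (Set.IccExtend_of_mem _ _ (normHeight_mem u.1)).symm⟩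
  map_one' := rfl
  map_mul' _ _ := rfl
  map_zero' := rfl
  map_add' _ _ := rfl
  commutes' _ := rfl

theorem heightFn_coordFn : heightFn coordFn = normCoord 4 := by
  ext u
  change ((‖u.1‖⁻¹ * u.1 4 : ℝ) : ℂ) = ((‖u.1‖⁻¹ : ℝ) : ℂ) * ((u.1 4 : ℝ) : ℂ)
  push_cast
  rfl

/-- On the polar axis the height is ±1, where f has only a one-sided derivative. The chain rule
still applies because the height takes values in the interval. -/
theorem partialD_heightFn (k : Fin 5) (f : SmoothFn) :
    partialD k (heightFn f) = heightFn (derivFn f) * partialD k (heightFn coordFn) := by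
  ext u
  have h0 : HasFDerivAt (fun u : E5 => ‖u‖⁻¹ * u 4) (fderiv ℝ (fun u : E5 => ‖u‖⁻¹ * u 4) u) u :=
    ((contDiffOn_normHeight.contDiffAt (punct_nhds u)).differentiableAt (by simp)).hasFDerivAt
  have h1 := (hasDerivWithinAt_derivFn f ⟨_, normHeight_mem u.1⟩).hasFDerivWithinAt.comp_hasFDerivAt
    u.1 h0 (Filter.Eventually.of_forall normHeight_mem)
  rw [partialD_apply_eq k (heightFn f) u _ _
    (fun u => (Set.IccExtend_of_mem _ _ (normHeight_mem u.1)).symm) h1]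
  change _ = (heightFn (derivFn f)).1 u * (partialD k (heightFn coordFn)).1 u
  rw [partialD_apply_eq k (heightFn coordFn) u _ _ (fun u => rfl)
    (Complex.ofRealCLM.hasFDerivAt.comp u.1 h0)]
  simp [heightFn, mul_comm]

theorem grad_heightFn (f : SmoothFn) :
    grad partialD (heightFn f) =
      heightFn (derivFn f) • grad partialD (heightFn coordFn) := by
  rw [grad_apply, grad_apply, Finset.smul_sum]
  exact Finset.sum_congr rfl fun k _ => by
    rw [partialD_heightFn, TensorProduct.smul_tmul', smul_eq_mul]

/-! ### Restriction to the sphere -/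

/-- The inclusion of the sphere. -/
def sphereIncl (p : S4) : Punct := ⟨p, fun h => by
  have hp : ‖(p : E5)‖ = 1 := by simp
  rw [Set.mem_singleton_iff.mp h, norm_zero] at hp
  exact zero_ne_one hp⟩

/-- Restriction to the sphere. -/
def toSphereFn : PunctFn →ₐ[ℂ] C(S4, ℂ) where
  toFun g := ⟨fun p => g.1 (sphereIncl p), by
    obtain ⟨G, hG, hg⟩ := g.2
    have h : (fun p : S4 => g.1 (sphereIncl p)) = G ∘ Subtype.val := funext fun p => hg _
    rw [h]
    exact hG.continuousOn.comp_continuous continuous_subtype_val fun p => (sphereIncl p).2⟩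
  map_one' := rfl
  map_mul' _ _ := rfl
  map_zero' := rfl
  map_add' _ _ := rfl
  commutes' _ := rfl

theorem toSphereFn_apply (g : PunctFn) (p : S4) : toSphereFn g p = g.1 (sphereIncl p) :=
  rfl

theorem toSphereFn_invNorm : toSphereFn invNorm = 1 := by
  ext p
  simp [toSphereFn_apply, invNorm, sphereIncl]

theorem toSphereFn_normCoord (k : Fin 5) (p : S4) :
    toSphereFn (normCoord k) p = ((p.1 k : ℝ) : ℂ) := by
  rw [normCoord, map_mul, toSphereFn_invNorm, one_mul]
  rfl

theorem toSphereFn_heightFn (f : SmoothFn) : toSphereFn (heightFn f) = classFn f := by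
  ext p
  change f.1 _ = f.1 _
  simp [sphereIncl]

theorem toSphereFn_complexCoord (i : Fin 4) : toSphereFn (complexCoord normCoord i) = classGen i := by
  ext p
  fin_cases i <;>
    simp [complexCoord, classGen, toSphereFn_normCoord]

theorem complexCoord_sphere :
    complexCoord normCoord 0 * complexCoord normCoord 1 +
      complexCoord normCoord 2 * complexCoord normCoord 3 + heightFn coordFn ^ 2 = 1 := by
  have hI : (algebraMap ℂ PunctFn Complex.I) ^ 2 = -1 := by
    rw [← map_pow, Complex.I_sq, map_neg, map_one]
  have h := sum_normCoord_sq
  rw [Fin.sum_univ_five] at h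
  simp only [complexCoord, Matrix.cons_val, heightFn_coordFn, Algebra.smul_def]
  linear_combination h - (normCoord 1 ^ 2 + normCoord 3 ^ 2) * hI

end Punctured

/-! ## Rotation invariance of the surface measure -/

section Rotation

open MeasureTheory Topology

open scoped Pointwise

/-- The map of the sphere induced by a linear isometry. -/
def isometrySphere (T : E5 ≃ₗᵢ[ℝ] E5) (p : S4) : S4 :=
  ⟨T p, by simp⟩

theorem continuous_isometrySphere (T : E5 ≃ₗᵢ[ℝ] E5) : Continuous (isometrySphere T) :=
  (T.continuous.comp continuous_subtype_val).subtype_mk _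

/-- The surface measure of a set is a constant multiple of the Lebesgue measure of the cone over it.
A linear isometry maps cones to cones and preserves Lebesgue measure. -/
theorem measurePreserving_isometrySphere (T : E5 ≃ₗᵢ[ℝ] E5) :
    MeasurePreserving (isometrySphere T) surfaceMeasure surfaceMeasure := by
  refine ⟨(continuous_isometrySphere T).measurable, ?_⟩
  ext s hs
  rw [Measure.map_apply (continuous_isometrySphere T).measurable hs, surfaceMeasure,
    Measure.toSphere_apply' _ hs,
    Measure.toSphere_apply' _ ((continuous_isometrySphere T).measurable hs)]
  have h : T ⁻¹' (Set.Ioo (0 : ℝ) 1 • ((↑) '' s)) =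
      Set.Ioo (0 : ℝ) 1 • ((↑) '' (isometrySphere T ⁻¹' s)) := by
    ext x
    simp only [Set.mem_preimage, Set.mem_smul, Set.mem_image]
    constructor
    · rintro ⟨r, hr, _, ⟨p, hp, rfl⟩, h⟩
      refine ⟨r, hr, T.symm p, ⟨⟨T.symm p, by simp⟩, ?_, rfl⟩, ?_⟩
      · change (⟨T (T.symm p), _⟩ : S4) ∈ s
        simpa using hp
      · rw [← map_smul, h, T.symm_apply_apply]
    · rintro ⟨r, hr, _, ⟨p, hp, rfl⟩, h⟩
      exact ⟨r, hr, T p, ⟨isometrySphere T p, hp, rfl⟩, by rw [← map_smul, h]⟩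
  rw [← h, T.measurePreserving.measure_preimage_emb T.toMeasurableEquiv.measurableEmbedding]

/-- The rotation by the angle `θ` in a coordinate plane, as a linear map. -/
def planeRotLin (k l : Fin 5) (θ : ℝ) : E5 →ₗ[ℝ] E5 where
  toFun x := x + ((Real.cos θ - 1) * x k - Real.sin θ * x l) • EuclideanSpace.single k (1 : ℝ) +
    ((Real.cos θ - 1) * x l + Real.sin θ * x k) • EuclideanSpace.single l (1 : ℝ)
  map_add' x y := by
    simp only [PiLp.add_apply]
    module
  map_smul' c x := by
    simp only [PiLp.smul_apply, smul_eq_mul, RingHom.id_apply]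
    module

/-- The rotation by the angle `θ` in a coordinate plane. -/
def planeRot {k l : Fin 5} (hkl : k ≠ l) (θ : ℝ) : E5 ≃ₗᵢ[ℝ] E5 :=
  LinearIsometry.toLinearIsometryEquiv
    { toLinearMap := planeRotLin k l θ
      norm_map' := fun x => by
        rw [← sq_eq_sq₀ (norm_nonneg _) (norm_nonneg _), EuclideanSpace.real_norm_sq_eq,
          EuclideanSpace.real_norm_sq_eq]
        have hc := Real.sin_sq_add_cos_sq θ
        have e : ∀ i, (planeRotLin k l θ x i) ^ 2 = (x i) ^ 2 +
            (if i = k then (Real.cos θ * x k - Real.sin θ * x l) ^ 2 - (x k) ^ 2 else 0) +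
            (if i = l then (Real.cos θ * x l + Real.sin θ * x k) ^ 2 - (x l) ^ 2 else 0) := by
          intro i
          change (x i + ((Real.cos θ - 1) * x k - Real.sin θ * x l) *
            (EuclideanSpace.single k (1 : ℝ)) i + ((Real.cos θ - 1) * x l + Real.sin θ * x k) *
            (EuclideanSpace.single l (1 : ℝ)) i) ^ 2 = _
          rcases eq_or_ne i k with rfl | hik
          · simp [hkl]; ring
          · rcases eq_or_ne i l with rfl | hil
            · simp [hik]; ring
            · simp [hik, hil]
        simp only [e, Finset.sum_add_distrib, Finset.sum_ite_eq',
          Finset.mem_univ, if_true]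
        linear_combination (x k ^ 2 + x l ^ 2) * hc }
    rfl

theorem planeRot_apply {k l : Fin 5} (hkl : k ≠ l) (θ : ℝ) (x : E5) :
    planeRot hkl θ x = x +
      ((Real.cos θ - 1) * x k - Real.sin θ * x l) • EuclideanSpace.single k (1 : ℝ) +
      ((Real.cos θ - 1) * x l + Real.sin θ * x k) • EuclideanSpace.single l (1 : ℝ) :=
  rfl

theorem hasDerivAt_planeRot {k l : Fin 5} (hkl : k ≠ l) (θ : ℝ) (x : E5) :
    HasDerivAt (fun θ => planeRot hkl θ x)
      ((planeRot hkl θ x k) • EuclideanSpace.single l (1 : ℝ) -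
        (planeRot hkl θ x l) • EuclideanSpace.single k (1 : ℝ)) θ := by
  have hxk : planeRot hkl θ x k = Real.cos θ * x k - Real.sin θ * x l := by
    rw [planeRot_apply]
    simp [hkl]
    ring
  have hxl : planeRot hkl θ x l = Real.cos θ * x l + Real.sin θ * x k := by
    rw [planeRot_apply]
    simp [hkl.symm]
    ring
  rw [hxk, hxl]
  simp only [planeRot_apply]
  have hk := (((((Real.hasDerivAt_cos θ).sub_const 1).mul_const (x k)).sub
    ((Real.hasDerivAt_sin θ).mul_const (x l))).smul_const
      (EuclideanSpace.single k (1 : ℝ) : E5)).const_add x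
  have hl := ((((Real.hasDerivAt_cos θ).sub_const 1).mul_const (x l)).add
    ((Real.hasDerivAt_sin θ).mul_const (x k))).smul_const
      (EuclideanSpace.single l (1 : ℝ) : E5)
  refine (hk.add hl).congr_deriv ?_
  module

/-- The infinitesimal rotation in a coordinate plane. -/
def infRot (k l : Fin 5) (g : PunctFn) : PunctFn :=
  linCoord k * partialD l g - linCoord l * partialD k g

theorem hasDerivAt_comp_planeRot {k l : Fin 5} (hkl : k ≠ l) (g : PunctFn) (p : S4) (θ : ℝ) :
    HasDerivAt (fun θ => toSphereFn g (isometrySphere (planeRot hkl θ) p))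
      (toSphereFn (infRot k l g) (isometrySphere (planeRot hkl θ) p)) θ := by
  have h := (hasFDerivAt_punctExt g
    (sphereIncl (isometrySphere (planeRot hkl θ) p))).comp_hasDerivAt θ
      (hasDerivAt_planeRot hkl θ p)
  rw [map_sub, map_smul, map_smul, Complex.real_smul, Complex.real_smul] at h
  exact h.congr_of_eventuallyEq (Filter.Eventually.of_forall fun θ =>
    (punctExt_apply g (sphereIncl (isometrySphere (planeRot hkl θ) p))).symm)

instance : IsFiniteMeasure surfaceMeasure := by
  unfold surfaceMeasure
  infer_instance

theorem integrable_surface (g : C(S4, ℂ)) : Integrable (fun p => g p) surfaceMeasure :=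
  g.continuous.integrable_of_hasCompactSupport (HasCompactSupport.of_compactSpace _)

/-- Rotation invariance makes the integral of g∘R_θ constant in θ, so its derivative vanishes. This
takes the place of Stokes' theorem. -/
theorem integral_infRot (k l : Fin 5) (g : PunctFn) :
    ∫ p, toSphereFn (infRot k l g) p ∂surfaceMeasure = 0 := by
  rcases eq_or_ne k l with rfl | hkl
  · simp [infRot]
  have hinv : ∀ (f : C(S4, ℂ)) (θ : ℝ),
      ∫ p, f (isometrySphere (planeRot hkl θ) p) ∂surfaceMeasure = ∫ p, f p ∂surfaceMeasure := by
    intro f θ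
    have hm := measurePreserving_isometrySphere (planeRot hkl θ)
    conv_rhs => rw [← hm.map_eq]
    rw [integral_map hm.measurable.aemeasurable f.continuous.aestronglyMeasurable]
  have hc : ∀ (f : C(S4, ℂ)) (θ : ℝ),
      Continuous fun p => f (isometrySphere (planeRot hkl θ) p) :=
    fun f θ => f.continuous.comp (continuous_isometrySphere _)
  have h := (hasDerivAt_integral_of_dominated_loc_of_deriv_le (μ := surfaceMeasure) (x₀ := (0 : ℝ))
    (F := fun θ p => toSphereFn g (isometrySphere (planeRot hkl θ) p))
    (F' := fun θ p => toSphereFn (infRot k l g) (isometrySphere (planeRot hkl θ) p))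
    (bound := fun _ => ‖toSphereFn (infRot k l g)‖) Filter.univ_mem
    (Filter.Eventually.of_forall fun θ => (hc _ θ).aestronglyMeasurable)
    ((hc _ 0).integrable_of_hasCompactSupport (HasCompactSupport.of_compactSpace _))
    (hc _ 0).aestronglyMeasurable
    (Filter.Eventually.of_forall fun p θ _ => ContinuousMap.norm_coe_le_norm _ _)
    (integrable_const _)
    (Filter.Eventually.of_forall fun p θ _ => hasDerivAt_comp_planeRot hkl g p θ)).2
  -- Invariance acts twice: the integral becomes constant in θ, and the integrand of its derivative
  -- at 0 loses its rotation.
  simp only [hinv] at h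
  exact h.unique (hasDerivAt_const _ _)

theorem surfaceMeasure_univ : surfaceMeasure.real Set.univ = 8 / 3 * Real.pi ^ 2 := by
  rw [surfaceMeasure, Measure.toSphere_real_apply_univ, Measure.real,
    InnerProductSpace.volume_ball_of_dim_odd (k := 2) (by simp)]
  simp [Nat.doubleFactorial]
  rw [ENNReal.toReal_ofReal (by positivity)]
  ring

end Rotation

/-! ## The volume form -/

section VolumeForm

open scoped TensorProduct

variable {R : Type} [CommRing R] [Algebra ℂ R]

/-- The generators of the exterior algebra, with coefficients. -/
def coGen (R : Type) [CommRing R] [Algebra ℂ R] (k : Fin 5) : R ⊗[ℂ] Ext5 := 1 ⊗ₜ extGen k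

theorem coGen_mul_self (k : Fin 5) : coGen R k * coGen R k = 0 := by
  rw [coGen, Algebra.TensorProduct.tmul_mul_tmul, extGen_mul_self, TensorProduct.tmul_zero]

theorem coGen_mul_comm (k l : Fin 5) : coGen R k * coGen R l = -(coGen R l * coGen R k) := by
  rw [coGen, coGen, Algebra.TensorProduct.tmul_mul_tmul, extGen_mul_comm, TensorProduct.tmul_neg,
    Algebra.TensorProduct.tmul_mul_tmul]

theorem coGen_mul_self_assoc (k : Fin 5) (v : R ⊗[ℂ] Ext5) :
    coGen R k * (coGen R k * v) = 0 := by
  rw [← mul_assoc, coGen_mul_self, zero_mul]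

theorem coGen_mul_comm_assoc (k l : Fin 5) (v : R ⊗[ℂ] Ext5) :
    coGen R k * (coGen R l * v) = -(coGen R l * (coGen R k * v)) := by
  rw [← mul_assoc, coGen_mul_comm, neg_mul, mul_assoc]

variable (y : Fin 5 → R)

/-- The one-form `∑ yₖ eₖ`. -/
def conormal : R ⊗[ℂ] Ext5 := ∑ k, y k ⊗ₜ extGen k

theorem conormal_eq : conormal y = ∑ k, y k • coGen R k := by
  simp [conormal, coGen, TensorProduct.smul_tmul']

theorem conormal_mul_coGen (k : Fin 5) : conormal y * coGen R k = -(coGen R k * conormal y) := by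
  rw [conormal_eq, Finset.sum_mul, Finset.mul_sum, ← Finset.sum_neg_distrib]
  exact Finset.sum_congr rfl fun l _ => by
    rw [smul_mul_assoc, mul_smul_comm, coGen_mul_comm, smul_neg]

theorem conormal_mul_self : conormal y * conormal y = 0 := by
  conv_lhs => rw [conormal_eq]
  rw [Finset.sum_mul_sum]
  refine sum_antisymm_eq_zero _ fun k l => ?_
  rw [smul_mul_smul_comm, smul_mul_smul_comm, coGen_mul_comm, smul_neg, mul_comm]

variable (D : Fin 5 → Derivation ℂ R R) (ρ : R)

/-- For the normalised coordinates this says that dyₖ is ρ times the tangential projection of eₖ. -/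
theorem grad_eq_of_partial (k : Fin 5)
    (h : ∀ l, D l (y k) = ρ * ((if k = l then 1 else 0) - y l * y k)) :
    grad D (y k) = ρ • (coGen R k - y k • conormal y) := by
  simp only [grad_apply, h, conormal_eq, coGen, Finset.smul_sum, smul_sub,
    TensorProduct.smul_tmul', smul_eq_mul, mul_one, mul_sub, TensorProduct.sub_tmul,
    Finset.sum_sub_distrib]
  congr 1
  · rw [Finset.sum_eq_single k] <;> simp +contextual [eq_comm]
  · exact Finset.sum_congr rfl fun l _ => by rw [mul_comm (y l)]

variable {y D ρ}

/-- Products with the conormal only see the tangential part of one-forms. -/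
theorem conormal_mul_grad (h : ∀ k, grad D (y k) = ρ • (coGen R k - y k • conormal y))
    (v : R ⊗[ℂ] Ext5) (hv : conormal y * v * conormal y = 0) (k : Fin 5) :
    conormal y * v * grad D (y k) = ρ • (conormal y * (v * coGen R k)) ∧
      conormal y * (v * coGen R k) * conormal y = 0 := by
  constructor
  · rw [h, mul_smul_comm, mul_sub, mul_smul_comm, hv, smul_zero, sub_zero, mul_assoc]
  · have h : coGen R k * conormal y = -(conormal y * coGen R k) := by
      rw [conormal_mul_coGen, neg_neg]
    rw [mul_assoc, mul_assoc, h, mul_neg, mul_neg, ← mul_assoc, ← mul_assoc, hv, zero_mul, neg_zero]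

/-- Starting from n∧n = 0, the normal parts of the four differentials drop out one after another,
each leaving a factor ρ. -/
theorem conormal_mul_grad_four (h : ∀ k, grad D (y k) = ρ • (coGen R k - y k • conormal y))
    (i j k l : Fin 5) :
    conormal y * (grad D (y i) * (grad D (y j) * (grad D (y k) * grad D (y l)))) =
      ρ ^ 4 • (conormal y * (coGen R i * (coGen R j * (coGen R k * coGen R l)))) := by
  obtain ⟨h1, h1'⟩ := conormal_mul_grad h 1 (by rw [mul_one, conormal_mul_self]) i
  obtain ⟨h2, h2'⟩ := conormal_mul_grad h _ h1' j
  obtain ⟨h3, h3'⟩ := conormal_mul_grad h _ h2' k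
  obtain ⟨h4, -⟩ := conormal_mul_grad h _ h3' l
  rw [mul_one] at h1
  rw [← mul_assoc, h1, smul_mul_assoc, ← mul_assoc, h2, smul_mul_assoc, ← mul_assoc, h3,
    smul_mul_assoc, h4, one_mul, smul_smul, smul_smul, smul_smul]
  simp only [mul_assoc, pow_succ, pow_zero, one_mul]

variable (y D)

/-- The form `¼ (t da da* db db* - 2 a dt da* db db* + 2 dt da da* db b*)` with commuting
coordinates. -/
def volForm : R ⊗[ℂ] Ext5 :=
  let d := grad D
  let x := complexCoord y
  (1 / 4 : ℂ) • (y 4 • (d (x 0) * (d (x 1) * (d (x 2) * d (x 3))))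
    - (2 : ℂ) • (x 0 • (d (y 4) * (d (x 1) * (d (x 2) * d (x 3)))))
    + (2 : ℂ) • (d (y 4) * (d (x 0) * (d (x 1) * (x 3 • d (x 2))))))

theorem grad_mul_self (r : R) : grad D r * grad D r = 0 := by
  have h := grad_mul_swap D r r
  have h2 : (2 : ℂ) • (grad D r * grad D r) = 0 := by
    rw [two_smul]
    nth_rewrite 1 [h]
    exact neg_add_cancel _
  exact (smul_eq_zero.mp h2).resolve_left two_ne_zero

theorem grad_complexCoord_pair (r s : R) :
    grad D (r + Complex.I • s) * grad D (r - Complex.I • s) =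
      (-(2 * Complex.I)) • (grad D r * grad D s) := by
  rw [map_add, map_sub, map_smul, add_mul, mul_sub, mul_sub, grad_mul_self, smul_mul_smul_comm,
    grad_mul_self, smul_mul_assoc, grad_mul_swap D s r, mul_smul_comm]
  module

/-- Here da∧da* = −2i dy₀∧dy₁ and db∧db* = −2i dy₂∧dy₃. In the first term (−2i)² = −4 meets the
factor ¼; in the others the remaining complex differential splits into real and imaginary parts. -/
theorem volForm_eq : volForm y D =
    -(y 4 • (grad D (y 0) * (grad D (y 1) * (grad D (y 2) * grad D (y 3)))))
    + (Complex.I • complexCoord y 0) •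
      (grad D (y 4) * (grad D (y 0) * (grad D (y 2) * grad D (y 3))))
    + complexCoord y 0 • (grad D (y 4) * (grad D (y 1) * (grad D (y 2) * grad D (y 3))))
    - (Complex.I • complexCoord y 3) •
      (grad D (y 4) * (grad D (y 0) * (grad D (y 1) * grad D (y 2))))
    + complexCoord y 3 • (grad D (y 4) * (grad D (y 0) * (grad D (y 1) * grad D (y 3)))) := by
  have h1 : grad D (complexCoord y 0) * grad D (complexCoord y 1) =
      (-(2 * Complex.I)) • (grad D (y 0) * grad D (y 1)) := grad_complexCoord_pair D (y 0) (y 1)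
  have h2 : grad D (complexCoord y 2) * grad D (complexCoord y 3) =
      (-(2 * Complex.I)) • (grad D (y 2) * grad D (y 3)) := grad_complexCoord_pair D (y 2) (y 3)
  have h3 : grad D (complexCoord y 1) = grad D (y 0) - Complex.I • grad D (y 1) := by
    rw [← map_smul, ← map_sub]
    rfl
  have h4 : grad D (complexCoord y 2) = grad D (y 2) + Complex.I • grad D (y 3) := by
    rw [← map_smul, ← map_add]
    rfl
  have e1 : grad D (complexCoord y 0) * (grad D (complexCoord y 1) *
      (complexCoord y 3 • grad D (complexCoord y 2))) =
      complexCoord y 3 • ((-(2 * Complex.I)) • (grad D (y 0) * (grad D (y 1) *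
        (grad D (y 2) + Complex.I • grad D (y 3))))) := by
    rw [← mul_assoc, h1, h4, mul_smul_comm, smul_mul_assoc, mul_assoc]
  have e2 : grad D (complexCoord y 0) * (grad D (complexCoord y 1) *
      (grad D (complexCoord y 2) * grad D (complexCoord y 3))) =
      (-4 : ℂ) • (grad D (y 0) * (grad D (y 1) * (grad D (y 2) * grad D (y 3)))) := by
    rw [← mul_assoc, h1, h2, smul_mul_smul_comm, mul_assoc]
    congr 1
    linear_combination 4 * Complex.I_mul_I
  simp only [volForm]
  rw [e1, e2, h2, h3]
  generalize complexCoord y 0 = a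
  generalize complexCoord y 3 = b
  simp only [sub_mul, mul_sub, mul_add, smul_mul_assoc, mul_smul_comm]
  generalize grad D (y 0) * (grad D (y 1) * (grad D (y 2) * grad D (y 3))) = P1
  generalize grad D (y 4) * (grad D (y 0) * (grad D (y 2) * grad D (y 3))) = P2
  generalize grad D (y 4) * (grad D (y 1) * (grad D (y 2) * grad D (y 3))) = P3
  generalize grad D (y 4) * (grad D (y 0) * (grad D (y 1) * grad D (y 2))) = P4
  generalize grad D (y 4) * (grad D (y 0) * (grad D (y 1) * grad D (y 3))) = P5
  have hI : (algebraMap ℂ R Complex.I) ^ 2 = -1 := by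
    rw [← map_pow, Complex.I_sq, map_neg, map_one]
  simp only [← algebraMap_smul R (_ : ℂ) (_ : R ⊗[ℂ] Ext5), Algebra.smul_def (_ : ℂ) (_ : R)]
  have hq : algebraMap ℂ R (1 / 4) * 4 = 1 := by
    rw [← map_ofNat (algebraMap ℂ R) 4, ← map_mul]
    norm_num
  match_scalars <;> simp only [Algebra.cast, map_ofNat]
  · linear_combination (-y 4) * hq
  · linear_combination (algebraMap ℂ R Complex.I * a) * hq
  · linear_combination -a * algebraMap ℂ R Complex.I ^ 2 * hq - a * hI
  · linear_combination -b * algebraMap ℂ R Complex.I * hq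
  · linear_combination -b * algebraMap ℂ R Complex.I ^ 2 * hq - b * hI

variable {y D}

-- Wedging with n multiplies each term by its missing coordinate. The cross terms i y₀y₁ and i y₂y₃
-- cancel, and the coefficients add up to −∑yₖ² = −1.
set_option linter.unusedSimpArgs false in
theorem conormal_mul_volForm (h : ∀ k, grad D (y k) = ρ • (coGen R k - y k • conormal y))
    (hy : ∑ k, y k ^ 2 = 1) :
    conormal y * volForm y D =
      -(ρ ^ 4 • (coGen R 4 * (coGen R 0 * (coGen R 1 * (coGen R 2 * coGen R 3))))) := by
  rw [volForm_eq]
  simp only [mul_add, mul_sub, mul_neg, mul_smul_comm, conormal_mul_grad_four h]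
  -- In each of the five products only the conormal component with the missing index survives;
  -- sorting the indices into the order 4, 0, 1, 2, 3 gives its sign.
  have k1 : conormal y * (coGen R 0 * (coGen R 1 * (coGen R 2 * coGen R 3))) =
      (y 4) •
        (coGen R 4 * (coGen R 0 * (coGen R 1 * (coGen R 2 * coGen R 3)))) := by
    rw [conormal_eq, Fin.sum_univ_five]
    simp only [add_mul, smul_mul_assoc, coGen_mul_self, coGen_mul_self_assoc, mul_neg, mul_zero,
      smul_zero, smul_neg, neg_neg, neg_zero, zero_add, add_zero, coGen_mul_comm_assoc 1 0,
      coGen_mul_comm_assoc 2 0, coGen_mul_comm_assoc 3 0, coGen_mul_comm_assoc 2 1,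
      coGen_mul_comm_assoc 3 1, coGen_mul_comm_assoc 3 2, coGen_mul_comm_assoc 0 4,
      coGen_mul_comm_assoc 1 4, coGen_mul_comm_assoc 2 4, coGen_mul_comm_assoc 3 4,
      coGen_mul_comm 3 2]
  have k2 : conormal y * (coGen R 4 * (coGen R 0 * (coGen R 2 * coGen R 3))) =
      (y 1) •
        (coGen R 4 * (coGen R 0 * (coGen R 1 * (coGen R 2 * coGen R 3)))) := by
    rw [conormal_eq, Fin.sum_univ_five]
    simp only [add_mul, smul_mul_assoc, coGen_mul_self, coGen_mul_self_assoc, mul_neg, mul_zero,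
      smul_zero, smul_neg, neg_neg, neg_zero, zero_add, add_zero, coGen_mul_comm_assoc 1 0,
      coGen_mul_comm_assoc 2 0, coGen_mul_comm_assoc 3 0, coGen_mul_comm_assoc 2 1,
      coGen_mul_comm_assoc 3 1, coGen_mul_comm_assoc 3 2, coGen_mul_comm_assoc 0 4,
      coGen_mul_comm_assoc 1 4, coGen_mul_comm_assoc 2 4, coGen_mul_comm_assoc 3 4,
      coGen_mul_comm 3 2]
  have k3 : conormal y * (coGen R 4 * (coGen R 1 * (coGen R 2 * coGen R 3))) =
      (-y 0) •
        (coGen R 4 * (coGen R 0 * (coGen R 1 * (coGen R 2 * coGen R 3)))) := by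
    rw [conormal_eq, Fin.sum_univ_five]
    simp only [add_mul, smul_mul_assoc, coGen_mul_self, coGen_mul_self_assoc, mul_neg, mul_zero,
      smul_zero, smul_neg, neg_neg, neg_zero, zero_add, add_zero, coGen_mul_comm_assoc 1 0,
      coGen_mul_comm_assoc 2 0, coGen_mul_comm_assoc 3 0, coGen_mul_comm_assoc 2 1,
      coGen_mul_comm_assoc 3 1, coGen_mul_comm_assoc 3 2, coGen_mul_comm_assoc 0 4,
      coGen_mul_comm_assoc 1 4, coGen_mul_comm_assoc 2 4, coGen_mul_comm_assoc 3 4,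
      coGen_mul_comm 3 2]
    module
  have k4 : conormal y * (coGen R 4 * (coGen R 0 * (coGen R 1 * coGen R 2))) =
      (y 3) •
        (coGen R 4 * (coGen R 0 * (coGen R 1 * (coGen R 2 * coGen R 3)))) := by
    rw [conormal_eq, Fin.sum_univ_five]
    simp only [add_mul, smul_mul_assoc, coGen_mul_self, coGen_mul_self_assoc, mul_neg, mul_zero,
      smul_zero, smul_neg, neg_neg, neg_zero, zero_add, add_zero, coGen_mul_comm_assoc 1 0,
      coGen_mul_comm_assoc 2 0, coGen_mul_comm_assoc 3 0, coGen_mul_comm_assoc 2 1,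
      coGen_mul_comm_assoc 3 1, coGen_mul_comm_assoc 3 2, coGen_mul_comm_assoc 0 4,
      coGen_mul_comm_assoc 1 4, coGen_mul_comm_assoc 2 4, coGen_mul_comm_assoc 3 4,
      coGen_mul_comm 3 2]
  have k5 : conormal y * (coGen R 4 * (coGen R 0 * (coGen R 1 * coGen R 3))) =
      (-y 2) •
        (coGen R 4 * (coGen R 0 * (coGen R 1 * (coGen R 2 * coGen R 3)))) := by
    rw [conormal_eq, Fin.sum_univ_five]
    simp only [add_mul, smul_mul_assoc, coGen_mul_self, coGen_mul_self_assoc, mul_neg, mul_zero,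
      smul_zero, smul_neg, neg_neg, neg_zero, zero_add, add_zero, coGen_mul_comm_assoc 1 0,
      coGen_mul_comm_assoc 2 0, coGen_mul_comm_assoc 3 0, coGen_mul_comm_assoc 2 1,
      coGen_mul_comm_assoc 3 1, coGen_mul_comm_assoc 3 2, coGen_mul_comm_assoc 0 4,
      coGen_mul_comm_assoc 1 4, coGen_mul_comm_assoc 2 4, coGen_mul_comm_assoc 3 4,
      coGen_mul_comm 3 2]
    module
  rw [k1, k2, k3, k4, k5]
  rw [Fin.sum_univ_five] at hy
  have hI : (algebraMap ℂ R Complex.I) ^ 2 = -1 := by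
    rw [← map_pow, Complex.I_sq, map_neg, map_one]
  simp only [complexCoord, Matrix.cons_val, Algebra.smul_def (_ : ℂ) (_ : R)]
  match_scalars
  linear_combination (-ρ ^ 4) * hy + ρ ^ 4 * (y 1 ^ 2 + y 3 ^ 2) * hI

end VolumeForm

/-! ## Integration of forms of degree four -/

section Integration

open MeasureTheory

open scoped TensorProduct

/-- Integration over the sphere. -/
def surfInt : C(S4, ℂ) →ₗ[ℂ] ℂ where
  toFun g := ∫ p, g p ∂surfaceMeasure
  map_add' f g := integral_add (integrable_surface f) (integrable_surface g)
  map_smul' c _ := integral_const_mul c _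

theorem surfInt_one : surfInt 1 = ((8 / 3 * Real.pi ^ 2 : ℝ) : ℂ) := by
  change ∫ _, (1 : ℂ) ∂surfaceMeasure = _
  rw [integral_const, surfaceMeasure_univ, Complex.real_smul, mul_one]

/-- Integration over the sphere of functions on the punctured space. -/
def punctInt : PunctFn →ₗ[ℂ] ℂ := surfInt ∘ₗ toSphereFn.toLinearMap

theorem punctInt_congr {f g : PunctFn} (h : toSphereFn f = toSphereFn g) :
    punctInt f = punctInt g :=
  congrArg surfInt h

theorem toSphereFn_linCoord (k : Fin 5) : toSphereFn (linCoord k) = toSphereFn (normCoord k) := by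
  rw [normCoord, map_mul, toSphereFn_invNorm, one_mul]

theorem punctInt_infRot (k l : Fin 5) (g : PunctFn) : punctInt (infRot k l g) = 0 :=
  integral_infRot k l g

theorem punctInt_normCoord_mul_partialD (k l : Fin 5) (g : PunctFn) :
    punctInt (normCoord k * partialD l g) = punctInt (normCoord l * partialD k g) := by
  rw [← sub_eq_zero, ← map_sub, ← punctInt_infRot k l g]
  refine punctInt_congr ?_
  simp [infRot, toSphereFn_linCoord]

/-- The coefficient of the top form `e₀ e₁ e₂ e₃ e₄`. -/
def topCoef : Ext5 →ₗ[ℂ] ℂ :=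
  ExteriorAlgebra.liftAlternating
    (Pi.single (M := fun i => (Fin 5 → ℂ) [⋀^Fin i]→ₗ[ℂ] ℂ) 5 Matrix.detRowAlternating)

/-- The cyclic order 4, 0, 1, 2, 3 is an even permutation. -/
theorem topCoef_cycle :
    topCoef (extGen 4 * (extGen 0 * (extGen 1 * (extGen 2 * extGen 3)))) = 1 := by
  have h : extGen 4 * (extGen 0 * (extGen 1 * (extGen 2 * extGen 3))) =
      ExteriorAlgebra.ιMulti ℂ 5
        ![Pi.single 4 1, Pi.single 0 1, Pi.single 1 1, Pi.single 2 1, Pi.single 3 1] := by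
    simp [ExteriorAlgebra.ιMulti_apply, extGen]
  have hdet : Matrix.det !![(0 : ℂ), 0, 0, 0, 1; 1, 0, 0, 0, 0; 0, 1, 0, 0, 0; 0, 0, 1, 0, 0;
      0, 0, 0, 1, 0] = 1 := by
    simp [Matrix.det_succ_row_zero, Fin.sum_univ_succ, Fin.succAbove, Even.neg_one_pow ⟨2, rfl⟩]
  rw [h, topCoef, ExteriorAlgebra.liftAlternating_apply_ιMulti, Pi.single_eq_same]
  refine (congrArg Matrix.det ?_).trans hdet
  ext i j
  fin_cases i <;> fin_cases j <;> rfl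

/-- The integral over the sphere of a form of degree four. -/
def volInt : PunctFn ⊗[ℂ] Ext5 →ₗ[ℂ] ℂ :=
  -((LinearMap.mul' ℂ ℂ ∘ₗ TensorProduct.map punctInt topCoef) ∘ₗ
    LinearMap.mulLeft ℂ (conormal normCoord))

theorem volInt_apply (v : PunctFn ⊗[ℂ] Ext5) :
    volInt v = -LinearMap.mul' ℂ ℂ (TensorProduct.map punctInt topCoef (conormal normCoord * v)) :=
  rfl

/-- The integral of yₖ∂ₗg is symmetric in k and l by rotation invariance, while eₖeₗ is
antisymmetric. -/
theorem volInt_extD (v : PunctFn ⊗[ℂ] Ext5) : volInt (extD partialD v) = 0 := by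
  induction v with
  | zero => simp
  | tmul g w =>
    rw [volInt_apply, extD_tmul, conormal, Finset.sum_mul_sum]
    simp only [Algebra.TensorProduct.tmul_mul_tmul, map_sum, TensorProduct.map_tmul,
      LinearMap.mul'_apply]
    rw [sum_antisymm_eq_zero, neg_zero]
    intro k l
    rw [punctInt_normCoord_mul_partialD, ← mul_assoc, ← mul_assoc, extGen_mul_comm, neg_mul,
      map_neg, mul_neg]
  | add v w hv hw => rw [map_add, map_add, hv, hw, add_zero]

theorem conormal_mul_sphereVolForm :
    conormal normCoord * volForm normCoord partialD =
      -(invNorm ^ 4 • (coGen PunctFn 4 * (coGen PunctFn 0 * (coGen PunctFn 1 *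
        (coGen PunctFn 2 * coGen PunctFn 3))))) :=
  conormal_mul_volForm
    (fun k => grad_eq_of_partial normCoord partialD invNorm k fun l => partialD_normCoord k l)
    sum_normCoord_sq

theorem pairing_smul_coGen_cycle {R : Type} [CommRing R] [Algebra ℂ R] (L : R →ₗ[ℂ] ℂ) (r s : R) :
    -LinearMap.mul' ℂ ℂ (TensorProduct.map L topCoef
      (r • -(s • (coGen R 4 * (coGen R 0 * (coGen R 1 * (coGen R 2 * coGen R 3))))))) =
      L (r * s) := by
  simp only [coGen, Algebra.TensorProduct.tmul_mul_tmul, mul_one, TensorProduct.smul_tmul',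
    smul_neg, smul_eq_mul, map_neg, neg_neg, TensorProduct.map_tmul, LinearMap.mul'_apply,
    topCoef_cycle]

/-- The sign in `volInt` compensates the one in `conormal_mul_sphereVolForm`, and ρ⁴ restricts to 1
on the sphere. -/
theorem volInt_smul_volForm (r : PunctFn) :
    volInt (r • volForm normCoord partialD) = punctInt r := by
  rw [volInt_apply, mul_smul_comm, conormal_mul_sphereVolForm, pairing_smul_coGen_cycle]
  refine punctInt_congr ?_
  rw [map_mul, map_pow, toSphereFn_invNorm, one_pow, mul_one]

end Integration

/-! ## The ordering map -/

section Ordering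

variable {φ : ℝ → ℝ} {hφ : ContDiffOn ℝ ∞ φ (Set.Icc (-1) 1)}

theorem DefSphere.induction {l : SmoothFn} {P : DefSphere l → Prop}
    (scalar : ∀ c, P (algebraMap ℂ _ c)) (gen : ∀ i, P (gen l i)) (fn : ∀ f, P (fnT l f))
    (mul : ∀ x y, P x → P y → P (x * y)) (add : ∀ x y, P x → P y → P (x + y))
    (x : DefSphere l) : P x := by
  obtain ⟨x, rfl⟩ := quoMk_surjective _ x
  induction x using FreeAlgebra.induction with
  | grade0 c => rw [AlgHom.commutes]; exact scalar c
  | grade1 a =>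
    cases a with
    | x i => exact gen i
    | fn f => exact fn f
  | mul x y hx hy => rw [map_mul]; exact mul _ _ hx hy
  | add x y hx hy => rw [map_add]; exact add _ _ hx hy

section Twist

variable {R : Type} [CommRing R] [Algebra ℂ R]
  {M : Type} [AddCommGroup M] [Module ℂ M] [Module R M] [IsScalarTower ℂ R M]
  {M' : Type} [AddCommGroup M'] [Module ℂ M'] [Module R M'] [IsScalarTower ℂ R M']
  (F : SmoothFn →ₐ[ℂ] R) (y : Fin 4 → R) (hy : y 0 * y 1 + y 2 * y 3 + F coordFn ^ 2 = 1)

/-- The twisted representation is natural in the module. -/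
theorem twistRep_mapRange (h : M →ₗ[R] M') (x : DefSphere (lam φ hφ)) (v : ℤ × ℤ →₀ M) :
    twistRep φ hφ F y hy M' x (Finsupp.mapRange h (map_zero h) v) =
      Finsupp.mapRange h (map_zero h) (twistRep φ hφ F y hy M x v) := by
  have hadd : ∀ u v : ℤ × ℤ →₀ M, Finsupp.mapRange h (map_zero h) (u + v) =
      Finsupp.mapRange h (map_zero h) u + Finsupp.mapRange h (map_zero h) v :=
    Finsupp.mapRange_add (map_add h)
  induction x using DefSphere.induction generalizing v with
  | scalar c =>
    simp only [AlgHom.commutes, Module.algebraMap_end_apply]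
    ext m
    simp only [Finsupp.smul_apply, Finsupp.mapRange_apply]
    rw [← algebraMap_smul R c (v m), map_smul, algebraMap_smul]
  | gen i =>
    induction v using Finsupp.induction_linear with
    | zero => simp
    | add u v hu hv => rw [hadd, map_add, map_add, hadd, hu, hv]
    | single m z => rw [Finsupp.mapRange_single, twistRep_gen, twistRep_gen,
        Finsupp.mapRange_single, map_smul]
  | fn f =>
    induction v using Finsupp.induction_linear with
    | zero => simp
    | add u v hu hv => rw [hadd, map_add, map_add, hadd, hu, hv]
    | single m z => rw [Finsupp.mapRange_single, twistRep_fnT, twistRep_fnT,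
        Finsupp.mapRange_single, map_smul]
  | mul x z hx hz => rw [map_mul, map_mul, Module.End.mul_apply, Module.End.mul_apply, hz, hx]
  | add x z hx hz => rw [map_add, map_add, LinearMap.add_apply, LinearMap.add_apply, hx, hz, hadd]

theorem twistRep_gen_apply (i : Fin 4) (v : ℤ × ℤ →₀ M) (m : ℤ × ℤ) :
    twistRep φ hφ F y hy M (gen _ i) v m =
      (F (halfPow φ hφ (weightPair (weight i) (m - weight i))) * y i) • v (m - weight i) := by
  induction v using Finsupp.induction_linear with
  | zero => simp
  | add u v hu hv => rw [map_add, Finsupp.add_apply, hu, hv, Finsupp.add_apply, smul_add]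
  | single n z =>
    rw [twistRep_gen, Finsupp.single_apply, Finsupp.single_apply]
    by_cases h : n + weight i = m
    · subst h
      simp
    · rw [if_neg h, if_neg (fun h' => h (by rw [h', sub_add_cancel])), smul_zero]

theorem twistRep_fnT_apply (f : SmoothFn) (v : ℤ × ℤ →₀ M) (m : ℤ × ℤ) :
    twistRep φ hφ F y hy M (fnT _ f) v m = F f • v m := by
  induction v using Finsupp.induction_linear with
  | zero => simp
  | add u v hu hv => rw [map_add, Finsupp.add_apply, hu, hv, Finsupp.add_apply, smul_add]
  | single n z =>
    rw [twistRep_fnT, Finsupp.single_apply, Finsupp.single_apply]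
    split_ifs <;> simp

theorem twistRep_gen_pow (i : Fin 4) (n : ℕ) (m : ℤ × ℤ) (v : M) :
    twistRep φ hφ F y hy M (gen _ i ^ n) (Finsupp.single m v) =
      Finsupp.single (m + n • weight i)
        ((F (halfPow φ hφ (n * weightPair (weight i) m)) * y i ^ n) • v) := by
  induction n with
  | zero => simp [halfPow_zero]
  | succ n ih =>
    rw [pow_succ', map_mul, Module.End.mul_apply, ih, twistRep_gen, smul_smul]
    -- Since ⟨wᵢ,wᵢ⟩ = 0, every factor of a power of one generator contributes the same phase.
    have h1 : weightPair (weight i) (m + n • weight i) = weightPair (weight i) m := by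
      simp only [weightPair, Prod.fst_add, Prod.snd_add, Prod.smul_fst, Prod.smul_snd]
      simp only [nsmul_eq_mul]
      ring
    have h2 : ((n + 1 : ℕ) : ℤ) * weightPair (weight i) m =
        weightPair (weight i) m + n * weightPair (weight i) m := by
      push_cast
      ring
    rw [h1, h2, halfPow_add, map_mul, succ_nsmul, add_assoc]
    congr 2
    ring

end Twist

/-- The twisted representation on functions. -/
abbrev funRep (x : DefSphere (lam φ hφ)) : Module.End ℂ (ℤ × ℤ →₀ PunctFn) :=
  twistRep φ hφ heightFn (complexCoord normCoord) complexCoord_sphere PunctFn x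

variable (φ hφ) in
/-- The passage from symmetric to normal ordering. -/
def orderSum : (ℤ × ℤ →₀ PunctFn) →ₗ[ℂ] C(S4, ℂ) :=
  Finsupp.lsum ℂ fun m => toSphereFn.toLinearMap ∘ₗ
    LinearMap.mulLeft ℂ (heightFn (halfPow φ hφ (-(m.1 * m.2))))

theorem orderSum_single (m : ℤ × ℤ) (g : PunctFn) :
    orderSum φ hφ (Finsupp.single m g) =
      toSphereFn (heightFn (halfPow φ hφ (-(m.1 * m.2))) * g) := by
  simp [orderSum]

variable (φ hφ) in
/-- The ordering map. -/
def orderMap : DefSphere (lam φ hφ) →ₗ[ℂ] C(S4, ℂ) :=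
  orderSum φ hφ ∘ₗ LinearMap.applyₗ (Finsupp.single 0 1) ∘ₗ
    (twistRep φ hφ heightFn (complexCoord normCoord) complexCoord_sphere PunctFn).toLinearMap

theorem orderMap_apply (x : DefSphere (lam φ hφ)) :
    orderMap φ hφ x = orderSum φ hφ (funRep x (Finsupp.single 0 1)) :=
  rfl

theorem isOrderingMap_orderMap : IsOrderingMap (lam φ hφ) (orderMap φ hφ) := by
  intro f j k m n
  have hh : ∀ p q r : ℤ, p + q + r = 0 →
      classFn (halfPow φ hφ p) * classFn (halfPow φ hφ q) * classFn (halfPow φ hφ r) = 1 := by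
    intro p q r h
    rw [← toSphereFn_heightFn, ← toSphereFn_heightFn, ← toSphereFn_heightFn, ← map_mul, ← map_mul,
      ← map_mul, ← map_mul, ← halfPow_add, ← halfPow_add, h, halfPow_zero, map_one, map_one]
  rw [orderMap_apply]
  simp only [map_mul, Module.End.mul_apply, twistRep_gen_pow, twistRep_fnT, orderSum_single]
  simp only [weightPair, weight, Matrix.cons_val, smul_eq_mul, map_mul, map_pow,
    toSphereFn_heightFn, toSphereFn_complexCoord, Prod.fst_add, Prod.snd_add, Prod.smul_mk,
    Prod.fst_zero, Prod.snd_zero, mul_zero, zero_mul, sub_zero, zero_add, add_zero,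
    smul_zero, halfPow_zero, map_one, mul_one, one_mul, nsmul_eq_mul, mul_neg, neg_zero]
  -- The b-part carries the vacuum to the label (0, m − n) without a phase. Then a*ᵏ and aʲ
  -- contribute (j − k)(m − n) half powers, the product of the components of the final label, which
  -- `orderSum` removes.
  linear_combination (classFn f * classGen 0 ^ j * classGen 1 ^ k * classGen 2 ^ m *
    classGen 3 ^ n) * hh (-((-k + j) * (-n + m))) (j * (-n + m)) (k * (-1 * (-n + m))) (by ring)

end Ordering

/-! ## Weights of functions -/

section Weights

theorem infRot_mul (k l : Fin 5) (f g : PunctFn) :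
    infRot k l (f * g) = f * infRot k l g + infRot k l f * g := by
  simp only [infRot, Derivation.leibniz, smul_eq_mul]
  ring

theorem infRot_add (k l : Fin 5) (f g : PunctFn) :
    infRot k l (f + g) = infRot k l f + infRot k l g := by
  simp only [infRot, map_add]
  ring

theorem infRot_sub (k l : Fin 5) (f g : PunctFn) :
    infRot k l (f - g) = infRot k l f - infRot k l g := by
  simp only [infRot, map_sub]
  ring

theorem infRot_smul (k l : Fin 5) (c : ℂ) (g : PunctFn) :
    infRot k l (c • g) = c • infRot k l g := by
  simp only [infRot, Derivation.map_smul, mul_smul_comm, smul_sub]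

theorem infRot_normCoord (k l j : Fin 5) :
    infRot k l (normCoord j) =
      (if j = l then normCoord k else 0) - (if j = k then normCoord l else 0) := by
  have h : ∀ i, (if j = i then (1 : PunctFn) else 0) * normCoord k =
      if j = i then normCoord k else 0 := fun i => by split_ifs <;> simp
  have h' : ∀ i, (if j = i then (1 : PunctFn) else 0) * normCoord l =
      if j = i then normCoord l else 0 := fun i => by split_ifs <;> simp
  rw [infRot, partialD_normCoord, partialD_normCoord, ← h, ← h']
  simp only [normCoord]
  ring

theorem infRot_heightFn (k l : Fin 5) (hk : 4 ≠ k) (hl : 4 ≠ l) (f : SmoothFn) :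
    infRot k l (heightFn f) = 0 := by
  have h : infRot k l (heightFn f) = heightFn (derivFn f) * infRot k l (normCoord 4) := by
    rw [infRot, partialD_heightFn, partialD_heightFn k, heightFn_coordFn, infRot]
    ring
  rw [h, infRot_normCoord, if_neg hk, if_neg hl, sub_zero, mul_zero]

/-- A function of a given weight under the action of the two-torus. -/
def HasWeight (m : ℤ × ℤ) (g : PunctFn) : Prop :=
  infRot 0 1 g = (Complex.I * m.1) • g ∧ infRot 2 3 g = (Complex.I * m.2) • g

theorem HasWeight.mul {m n : ℤ × ℤ} {f g : PunctFn} (hf : HasWeight m f) (hg : HasWeight n g) :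
    HasWeight (m + n) (f * g) := by
  constructor
  · rw [infRot_mul, hf.1, hg.1, mul_smul_comm, smul_mul_assoc, ← add_smul, Prod.fst_add]
    push_cast
    congr 1
    ring
  · rw [infRot_mul, hf.2, hg.2, mul_smul_comm, smul_mul_assoc, ← add_smul, Prod.snd_add]
    push_cast
    congr 1
    ring

theorem HasWeight.add {m : ℤ × ℤ} {f g : PunctFn} (hf : HasWeight m f) (hg : HasWeight m g) :
    HasWeight m (f + g) := by
  constructor
  · rw [infRot_add, hf.1, hg.1, smul_add]
  · rw [infRot_add, hf.2, hg.2, smul_add]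

theorem HasWeight.smul {m : ℤ × ℤ} {g : PunctFn} (c : ℂ) (hg : HasWeight m g) :
    HasWeight m (c • g) := by
  constructor
  · rw [infRot_smul, hg.1, smul_comm]
  · rw [infRot_smul, hg.2, smul_comm]

theorem hasWeight_zero (m : ℤ × ℤ) : HasWeight m 0 := by
  constructor <;> simp [infRot]

theorem hasWeight_heightFn (f : SmoothFn) : HasWeight 0 (heightFn f) := by
  constructor
  · rw [infRot_heightFn 0 1 (by decide) (by decide)]
    simp
  · rw [infRot_heightFn 2 3 (by decide) (by decide)]
    simp

theorem hasWeight_complexCoord (i : Fin 4) : HasWeight (weight i) (complexCoord normCoord i) := by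
  fin_cases i <;> constructor <;>
    simp [weight, complexCoord, infRot_add, infRot_sub, infRot_smul, infRot_normCoord, smul_add,
      smul_sub, smul_smul, add_comm] <;>
    module

/-- The infinitesimal rotations act by i·m₁ and i·m₂, one of which is nonzero, while their images
integrate to zero. -/
theorem HasWeight.punctInt_eq_zero {m : ℤ × ℤ} {g : PunctFn} (hg : HasWeight m g) (hm : m ≠ 0) :
    punctInt g = 0 := by
  have h1 := punctInt_infRot 0 1 g
  have h2 := punctInt_infRot 2 3 g
  rw [hg.1, map_smul, smul_eq_mul, mul_eq_zero] at h1
  rw [hg.2, map_smul, smul_eq_mul, mul_eq_zero] at h2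
  by_contra hne
  have e1 := h1.resolve_right hne
  have e2 := h2.resolve_right hne
  simp only [mul_eq_zero, Complex.I_ne_zero, false_or, Int.cast_eq_zero] at e1 e2
  exact hm (Prod.ext e1 e2)

variable {φ : ℝ → ℝ} {hφ : ContDiffOn ℝ ∞ φ (Set.Icc (-1) 1)}

/-- Phases are functions of the height and have weight 0, so each generator changes the label and
the torus weight by the same amount. -/
theorem hasWeight_funRep (x : DefSphere (lam φ hφ)) (v : ℤ × ℤ →₀ PunctFn)
    (hv : ∀ m, HasWeight m (v m)) (m : ℤ × ℤ) : HasWeight m (funRep x v m) := by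
  induction x using DefSphere.induction generalizing v m with
  | scalar c =>
    rw [funRep, AlgHom.commutes, Module.algebraMap_end_apply]
    exact (hv m).smul c
  | gen i =>
    rw [funRep, twistRep_gen_apply]
    have h := ((hasWeight_heightFn (halfPow φ hφ (weightPair (weight i) (m - weight i)))).mul
      (hasWeight_complexCoord i)).mul (hv (m - weight i))
    rwa [zero_add, add_sub_cancel] at h
  | fn f =>
    rw [funRep, twistRep_fnT_apply]
    have h := (hasWeight_heightFn f).mul (hv m)
    rwa [zero_add] at h
  | mul x y hx hy =>
    rw [funRep, map_mul]
    exact hx _ (fun m => hy v hv m) m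
  | add x y hx hy =>
    rw [funRep, map_add]
    exact (hx v hv m).add (hy v hv m)

/-- Only label 0 survives integration, and its ordering exponent is 0. The integral therefore does
not see the ordering correction. -/
theorem surfInt_orderSum (v : ℤ × ℤ →₀ PunctFn) (hv : ∀ m, HasWeight m (v m)) :
    surfInt (orderSum φ hφ v) = punctInt (v 0) := by
  rw [orderSum, Finsupp.lsum_apply, Finsupp.sum, map_sum]
  have h : ∀ m, surfInt ((toSphereFn.toLinearMap ∘ₗ
      LinearMap.mulLeft ℂ (heightFn (halfPow φ hφ (-(m.1 * m.2))))) (v m)) =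
      punctInt (heightFn (halfPow φ hφ (-(m.1 * m.2))) * v m) := fun m => rfl
  simp only [h]
  rw [Finset.sum_eq_single 0]
  · simp [halfPow_zero]
  · intro m _ hm
    have hw := (hasWeight_heightFn (halfPow φ hφ (-(m.1 * m.2)))).mul (hv m)
    rw [zero_add] at hw
    exact hw.punctInt_eq_zero hm
  · intro h0
    rw [Finsupp.notMem_support_iff.mp h0, mul_zero, map_zero]

theorem surfInt_orderMap (x : DefSphere (lam φ hφ)) :
    surfInt (orderMap φ hφ x) = punctInt (funRep x (Finsupp.single 0 1) 0) := by
  refine surfInt_orderSum _ (hasWeight_funRep x _ fun m => ?_)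
  rw [Finsupp.single_apply]
  split_ifs with h
  · subst h
    rw [← map_one heightFn]
    exact hasWeight_heightFn 1
  · exact hasWeight_zero m

end Weights

/-! ## The integral on the deformed sphere -/

section Integral

open scoped TensorProduct

variable (φ : ℝ → ℝ) (hφ : ContDiffOn ℝ ∞ φ (Set.Icc (-1) 1))

/-! ### The calculus acting on labelled forms, and the image of ω -/

section Omega

variable {R : Type} [CommRing R] [Algebra ℂ R] (D : Fin 5 → Derivation ℂ R R)
  (F : SmoothFn →ₐ[ℂ] R) (y : Fin 5 → R)
  (hy : complexCoord y 0 * complexCoord y 1 + complexCoord y 2 * complexCoord y 3 +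
    F coordFn ^ 2 = 1)
  (hD : ∀ k l r, D k (D l r) = D l (D k r))
  (hF : ∀ f, grad D (F f) = F (derivFn f) • grad D (F coordFn))

/-- The action of the differential algebra of the deformed sphere on labelled forms. -/
def calcRep : SphereAllForms (lam φ hφ) →ₐ[ℂ] Module.End ℂ (ℤ × ℤ →₀ R ⊗[ℂ] Ext5) :=
  fRep (twistRep φ hφ F (complexCoord y) hy (R ⊗[ℂ] Ext5)) (oneFormRels_subset _)
    (labD_mul_self D hD) (formOp_oneFormRels D φ hφ F (complexCoord y) hy hF)

theorem calcRep_fEl (x : DefSphere (lam φ hφ)) :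
    calcRep φ hφ D F y hy hD hF (fEl _ x) =
      twistRep φ hφ F (complexCoord y) hy (R ⊗[ℂ] Ext5) x :=
  fRep_fEl _ _ _ _ _

theorem calcRep_fD (x : DefSphere (lam φ hφ)) :
    calcRep φ hφ D F y hy hD hF (fD _ x) = formOp D φ hφ F (complexCoord y) hy (uD _ x) := by
  rw [uRep_uD]
  exact fRep_fD _ _ _ _ _

theorem calcRep_sphereD (θ : SphereForms (lam φ hφ) 3) :
    calcRep φ hφ D F y hy hD hF (sphereD (lam φ hφ) 3 θ).1 (Finsupp.single 0 1) =
      labD D (calcRep φ hφ D F y hy hD hF θ.1 (Finsupp.single 0 1)) :=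
  fRep_fDiff_apply _ _ _ _ _ (by rw [labD_single, extD_one, Finsupp.single_zero])

/-- In every term the letters b*, b act before a*, a, and each pair that occurs returns the label to
0. All pairings met on the way vanish, so no power of λ appears. -/
theorem calcRep_omega (hyF : F coordFn = y 4) :
    calcRep φ hφ D F y hy hD hF (omega (lam φ hφ)).1 (Finsupp.single 0 1) =
      Finsupp.single 0 (volForm y D) := by
  simp only [omega, map_smul, map_add, map_sub, map_mul, calcRep_fEl, calcRep_fD, tEl,
    LinearMap.smul_apply, LinearMap.add_apply, LinearMap.sub_apply, Module.End.mul_apply,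
    twistRep_gen, twistRep_fnT, formOp_uD_gen, formOp_uD_fnT]
  simp [weight, weightPair, halfPow_zero, hyF]
  rw [← Finsupp.single_sub, Finsupp.smul_single, ← Finsupp.single_add]
  simp [volForm]
  rfl

theorem calcRep_mulForm_omega (hyF : F coordFn = y 4) (x : DefSphere (lam φ hφ)) :
    calcRep φ hφ D F y hy hD hF (mulForm (lam φ hφ) x (omega (lam φ hφ))).1
        (Finsupp.single 0 1) 0 =
      twistRep φ hφ F (complexCoord y) hy R x (Finsupp.single 0 1) 0 • volForm y D := by
  change calcRep φ hφ D F y hy hD hF (fEl _ x * (omega (lam φ hφ)).1) _ _ = _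
  -- The map r ↦ r·ω is linear over the coefficient ring, so naturality transfers the action of x
  -- from forms to functions.
  have h := twistRep_mapRange (φ := φ) (hφ := hφ) F (complexCoord y) hy
    (LinearMap.toSpanSingleton R (R ⊗[ℂ] Ext5) (volForm y D)) x (Finsupp.single 0 1)
  rw [Finsupp.mapRange_single, LinearMap.toSpanSingleton_apply, one_smul] at h
  rw [map_mul, Module.End.mul_apply, calcRep_omega φ hφ D F y hy hD hF hyF, calcRep_fEl, h,
    Finsupp.mapRange_apply, LinearMap.toSpanSingleton_apply]

end Omega

/-- The action of the differential algebra on labelled forms on the punctured space. -/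
def sphereRep :
    SphereAllForms (lam φ hφ) →ₐ[ℂ] Module.End ℂ (ℤ × ℤ →₀ PunctFn ⊗[ℂ] Ext5) :=
  calcRep φ hφ partialD heightFn normCoord complexCoord_sphere partialD_comm grad_heightFn

/-- The integral of forms of degree four. -/
def sphereInt : SphereForms (lam φ hφ) 4 →ₗ[ℂ] ℂ :=
  volInt ∘ₗ Finsupp.lapply 0 ∘ₗ LinearMap.applyₗ (Finsupp.single 0 1) ∘ₗ
    (sphereRep φ hφ).toLinearMap ∘ₗ (SphereForms (lam φ hφ) 4).subtype

theorem sphereInt_apply (θ : SphereForms (lam φ hφ) 4) :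
    sphereInt φ hφ θ = volInt (sphereRep φ hφ θ.1 (Finsupp.single 0 1) 0) :=
  rfl

theorem sphereInt_mulForm_omega (x : DefSphere (lam φ hφ)) :
    sphereInt φ hφ (mulForm (lam φ hφ) x (omega (lam φ hφ))) = surfInt (orderMap φ hφ x) := by
  rw [sphereInt_apply, sphereRep, calcRep_mulForm_omega _ _ _ _ _ _ _ _ heightFn_coordFn,
    volInt_smul_volForm, surfInt_orderMap]

theorem sphereInt_sphereD (θ : SphereForms (lam φ hφ) 3) :
    sphereInt φ hφ (sphereD (lam φ hφ) 3 θ) = 0 := by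
  rw [sphereInt_apply, sphereRep, calcRep_sphereD]
  exact volInt_extD _

theorem sphereInt_omega :
    sphereInt φ hφ (omega (lam φ hφ)) = ((8 / 3 * Real.pi ^ 2 : ℝ) : ℂ) := by
  have h : mulForm (lam φ hφ) 1 (omega (lam φ hφ)) = omega (lam φ hφ) := by
    ext
    change fEl _ 1 * (omega (lam φ hφ)).1 = _
    rw [map_one, one_mul]
  have h1 : orderMap φ hφ 1 = 1 := by
    rw [orderMap_apply, funRep, map_one, Module.End.one_apply, orderSum_single]
    simp [halfPow_zero]
  rw [← h, sphereInt_mulForm_omega, h1, surfInt_one]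

end Integral

end DynamicalSphere

end

theorem mainTheorem5 (φ : ℝ → ℝ) (hφ : ContDiffOn ℝ ∞ φ (Set.Icc (-1) 1)) :
    ∃ η : DynamicalSphere.DefSphere (DynamicalSphere.lam φ hφ) →ₗ[ℂ] C(DynamicalSphere.S4, ℂ),
      DynamicalSphere.IsOrderingMap (DynamicalSphere.lam φ hφ) η ∧
      ∃ I : DynamicalSphere.SphereForms (DynamicalSphere.lam φ hφ) 4 →ₗ[ℂ] ℂ,
        (∀ x : DynamicalSphere.DefSphere (DynamicalSphere.lam φ hφ),
          I (DynamicalSphere.mulForm (DynamicalSphere.lam φ hφ) x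
              (DynamicalSphere.omega (DynamicalSphere.lam φ hφ)))
            = ∫ p, η x p ∂DynamicalSphere.surfaceMeasure) ∧
        (∀ ρ : DynamicalSphere.SphereForms (DynamicalSphere.lam φ hφ) 3,
          I (DynamicalSphere.sphereD (DynamicalSphere.lam φ hφ) 3 ρ) = 0) ∧
        I (DynamicalSphere.omega (DynamicalSphere.lam φ hφ)) = ((8 / 3 * Real.pi ^ 2 : ℝ) : ℂ) :=
  ⟨DynamicalSphere.orderMap φ hφ, DynamicalSphere.isOrderingMap_orderMap,
    DynamicalSphere.sphereInt φ hφ, DynamicalSphere.sphereInt_mulForm_omega φ hφ,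
    DynamicalSphere.sphereInt_sphereD φ hφ, DynamicalSphere.sphereInt_omega φ hφ⟩
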